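/- Let $d\in\mathbb N$ and let $P\in\mathbb Z[x]$ be monic of degree $d$, irreducible over $\mathbb Q$, with $d$ distinct real roots $\xi_1,\dots,\xi_d$. Let $V=(\xi_i^{\,j-1})_{i,j=1}^d$ be the Vandermonde matrix, $D_P:=|\det V|=\prod_{k<l}|\xi_k-\xi_l|$, and $$B_P:=\min_{U\in \mathrm{SL}_d(\mathbb Z)}\|VU\|_\infty ,$$ where $\|\cdot\|_\infty$ is the operator norm with respect to the $\ell_\infty$-norm (maximal absolute row sum). For $n\in\mathbb N$ put $A_n:=n^{-1/d}D_P^{-1/d}V$ and $$Q_n^d(f):=\frac1n\sum_{k\in\mathbb Z^d}f(A_nk),\qquad I_d(f):=\int_{[0,1]^d}f(x)\,dx .$$ Let $\mathbf r=(r_1,\dots,r_d)$ with integers $r_i\ge 1$, and let $\mathring H^{\mathbf r}_{\mathrm{mix}}$ be the completion of $C_0^\infty((0,1)^d)$ (real-valued functions) with respect to the norm given by $\sum_{e\subset[d]}\big\|\big(\prod_{i\in e}\partial^{r_i}/\partial x_i^{r_i}\big)\varphi\big\|_{L_2(\mathbb R^d)}^2$; its elements are identified with continuous functions on $\mathbb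 R^d$ vanishing outside $(0,1)^d$, and it is equipped with the equivalent norm $$\|f\|:=\|f^{(\mathbf r)}\|_{L_2([0,1]^d)},$$ where $f^{(\mathbf r)}$ is the weak derivative of order $r_i$ in each variable $x_i$. Let $r:=\min_j r_j$, $\eta:=\#\{j: r_j=r\}$ and $r':=\min\{r_j: r_j\ne r\}$, and let $$C(d,\eta,\mathbf r):=2^{d+1}\bigl(1-2^{-2(r'-r)}\bigr)^{-(d-\eta)/2}\bigl(1-2^{1-2r}\bigr)^{-\eta/2}\Bigl(\sum_{e\subset[d]}\prod_{i\in e}\frac1{[(r_i-1)!]^2(2r_i-1)2r_i}\Bigr)^{1/2},$$ where the factor containing $r'$ is read as $1$ if $\eta=d$. Then for every $f\in\mathring H^{\mathbf r}_{\mathrm{mix}}$ and every $n\in\mathbb N$ such that $\eta=1$ or $2+\log(n/D_P)\ge 1$, $$|Q_n^d(f)-I_d(f)|\le C(d,\eta,\mathbf r)\,\max\Bigl\{D_P,\frac{(2B_P)^d}{n}\Bigr\}^{1/2}\Bigl(\frac{D_P}{n}\Bigr)^{r}\bigl(2+\log(n/D_P)\bigr)^{(\eta-1)/2}\,\|f\|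 .$$ Here $\log$ is the natural logarithm, and for $\eta=1$ the logarithmic factor is $1$. -/

import Mathlib

namespace Frolov

/-! ### The function space -/

/-- The open unit cube `(0,1)^d`. -/
def openCube (d : ℕ) : TopologicalSpace.Opens (Fin d → ℝ) where
  carrier := Set.univ.pi fun _ => Set.Ioo 0 1
  is_open' := isOpen_set_pi Set.finite_univ fun _ _ => isOpen_Ioo

/-- The partial derivative `∂φ/∂x_i`. -/
noncomputable def partialDeriv {d : ℕ} (i : Fin d) (φ : (Fin d → ℝ) → ℝ) : (Fin d → ℝ) → ℝ :=
  fun x => lineDeriv ℝ φ x (Pi.single i 1)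

/-- The classical mixed derivative `(∏_i ∂^{α_i}/∂x_i^{α_i}) φ` of a smooth function. -/
noncomputable def mixedDeriv {d : ℕ} (α : Fin d → ℕ) (φ : (Fin d → ℝ) → ℝ) :
    (Fin d → ℝ) → ℝ :=
  (List.finRange d).foldr (fun i g => (partialDeriv i)^[α i] g) φ

/-- The norm `‖φ‖_{H^r_mix}` of a smooth compactly supported function:
`‖φ‖² = ∑_{e ⊆ [d]} ‖(∏_{i ∈ e} ∂^{r_i}/∂x_i^{r_i}) φ‖²_{L₂(ℝ^d)}`. -/
noncomputable def hmixNorm {d : ℕ} (r : Fin d → ℕ) (φ : (Fin d → ℝ) → ℝ) : ℝ :=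
  Real.sqrt (∑ e : Finset (Fin d), ∫ x, mixedDeriv (fun i => if i ∈ e then r i else 0) φ x ^ 2)

/-- `f` belongs to the completion of `C_0^∞((0,1)^d)` with respect to `‖·‖_{H^r_mix}`. As this norm
dominates the `L₂`-norm and differentiation is closable, the completion is realised as the set of
those (continuous representatives of) `L₂`-limits of sequences in `C_0^∞((0,1)^d)` which are Cauchy
with respect to `‖·‖_{H^r_mix}`. -/
structure MemHmix {d : ℕ} (r : Fin d → ℕ) (f : (Fin d → ℝ) → ℝ) : Prop where
  continuous : Continuous f
  exists_approx : ∃ φ : ℕ → TestFunction (openCube d) ℝ ⊤,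
    (∀ ε > 0, ∃ N, ∀ k ≥ N, ∀ l ≥ N, hmixNorm r (fun x => φ k x - φ l x) < ε) ∧
    Filter.Tendsto (fun k => MeasureTheory.eLpNorm (fun x => φ k x - f x) 2 MeasureTheory.volume)
      Filter.atTop (nhds 0)

/-- `g` is a weak derivative `f^{(α)}` of `f` on `ℝ^d`. -/
def HasWeakDeriv {d : ℕ} (α : Fin d → ℕ) (f g : (Fin d → ℝ) → ℝ) : Prop :=
  MeasureTheory.LocallyIntegrable g MeasureTheory.volume ∧
    ∀ ψ : TestFunction (⊤ : TopologicalSpace.Opens (Fin d → ℝ)) ℝ ⊤,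
      ∫ x, f x * mixedDeriv α ψ x = (-1) ^ (∑ i, α i) * ∫ x, g x * ψ x

open Classical in
/-- The weak derivative `f^{(α)}`, which is unique up to null sets (and `0` if there is none). -/
noncomputable def weakDeriv {d : ℕ} (α : Fin d → ℕ) (f : (Fin d → ℝ) → ℝ) : (Fin d → ℝ) → ℝ :=
  if h : ∃ g, HasWeakDeriv α f g then h.choose else 0

/-- The norm `‖f‖ = (∫_{[0,1]^d} |f^{(r)}(x)|² dx)^{1/2}` of the Hilbert space of all functions `f`
with `MemHmix r f`. -/
noncomputable def spaceNorm {d : ℕ} (r : Fin d → ℕ) (f : (Fin d → ℝ) → ℝ) : ℝ :=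
  Real.sqrt (∫ x in Set.Icc (0 : Fin d → ℝ) 1, weakDeriv r f x ^ 2)

/-! ### The lattice and the cubature rule -/

/-- `P` is an admissible polynomial of degree `d` and `ξ` enumerates its `d` distinct roots, all of
which are real. -/
structure IsAdmissible {d : ℕ} (P : Polynomial ℤ) (ξ : Fin d → ℝ) : Prop where
  natDegree_eq : P.natDegree = d
  monic : P.Monic
  irreducible : Irreducible (P.map (Int.castRingHom ℚ))
  injective : Function.Injective ξ
  root : ∀ i, Polynomial.aeval (ξ i) P = 0

/-- `D_P = |det V|`, where `V = (ξ_i^{j-1})` is the Vandermonde matrix of the roots of `P`. -/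
noncomputable def discr {d : ℕ} (ξ : Fin d → ℝ) : ℝ :=
  |(Matrix.vandermonde ξ).det|

section

attribute [local instance] Matrix.linftyOpNormedAddCommGroup

/-- `B_P = min_U ‖V U‖_∞` over `U ∈ SL_d(ℤ)`, where `‖·‖_∞` is the operator norm of a matrix
with respect to the `ℓ_∞`-norm (the maximal absolute row sum). -/
noncomputable def cellSize {d : ℕ} (ξ : Fin d → ℝ) : ℝ :=
  ⨅ U : Matrix.SpecialLinearGroup (Fin d) ℤ,
    ‖Matrix.vandermonde ξ * (U : Matrix (Fin d) (Fin d) ℤ).map (Int.cast : ℤ → ℝ)‖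

end

/-- `A_n = n^{-1/d} A` with `A = |det V|^{-1/d} V`. -/
noncomputable def cubatureMatrix {d : ℕ} (ξ : Fin d → ℝ) (n : ℕ) : Matrix (Fin d) (Fin d) ℝ :=
  (n : ℝ) ^ (-(1 / d : ℝ)) • (|(Matrix.vandermonde ξ).det| ^ (-(1 / d : ℝ)) • Matrix.vandermonde ξ)

/-- Frolov's cubature rule `Q_n^d f = (1/n) ∑_{k ∈ ℤ^d} f(A_n k)`. Only finitely many terms are
nonzero if `f` vanishes outside of `[0,1]^d`. -/
noncomputable def cubature {d : ℕ} (ξ : Fin d → ℝ) (n : ℕ) (f : (Fin d → ℝ) → ℝ) : ℝ :=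
  1 / n * ∑' k : Fin d → ℤ, f ((cubatureMatrix ξ n).mulVec fun i => (k i : ℝ))

/-- `I_d f = ∫_{[0,1]^d} f(x) dx`. -/
noncomputable def exactIntegral {d : ℕ} (f : (Fin d → ℝ) → ℝ) : ℝ :=
  ∫ x in Set.Icc (0 : Fin d → ℝ) 1, f x

/-! ### The constants -/

/-- `r = min_j r_j`. -/
noncomputable def leastSmoothness {d : ℕ} (r : Fin d → ℕ) : ℕ :=
  sInf (Set.range r)

/-- `η = #{j : r_j = r}`. -/
noncomputable def numMin {d : ℕ} (r : Fin d → ℕ) : ℕ :=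
  (Finset.univ.filter fun j => r j = leastSmoothness r).card

/-- `r' = min {r_j : r_j ≠ r}` (with value `0` if all `r_j` are equal). -/
noncomputable def nextSmoothness {d : ℕ} (r : Fin d → ℕ) : ℕ :=
  sInf {m | (∃ j, r j = m) ∧ m ≠ leastSmoothness r}

/-- The constant `C(d,η,r)`. If all `r_j` are equal, then `d - η = 0`, so that the factor which
contains `r'` is `1`. -/
noncomputable def constant {d : ℕ} (r : Fin d → ℕ) : ℝ :=
  2 ^ (d + 1)
    * (1 - (2 : ℝ) ^ (-(2 * ((nextSmoothness r : ℝ) - leastSmoothness r))))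
        ^ (-(((d : ℝ) - numMin r) / 2))
    * (1 - (2 : ℝ) ^ (1 - 2 * (leastSmoothness r : ℝ))) ^ (-((numMin r : ℝ) / 2))
    * (∑ e : Finset (Fin d), ∏ i ∈ e,
        1 / (((r i - 1).factorial : ℝ) ^ 2 * (2 * (r i : ℝ) - 1) * (2 * (r i : ℝ)))) ^ (1 / 2 : ℝ)

end Frolov

namespace Frolov

open Matrix Polynomial

/-! ### Norms and traces in ℤ[x]/(P): admissibility of the lattice and of its dual -/

section NumberTheory

variable {d : ℕ} {P : ℤ[X]} {ξ : Fin d → ℝ}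

/-! The coordinates of `V k` are the values of one integer polynomial at all roots of `P`. Their
product is a norm, hence an integer, and irreducibility of `P` makes it nonzero for `k ≠ 0`. A
Hankel determinant gives an analogous bound for the dual lattice. After scaling, nonzero points of
`A_n ℤ^d` satisfy `∏|x_i| ≥ 1/(n D_P)`, and nonzero dual points satisfy `∏|z_i| ≥ T = n/D_P`
(`le_prod_cubatureMatrix`, `le_prod_dual`). Both bounds are used.

By Poisson summation (`tsum_eq_tsum_ft`) the error is the sum of the Fourier transform of `f` over
the nonzero dual points. Cauchy–Schwarz with the weight `ν(z) = ∏(1 + (2π z_i)^{2 r_i})` leaves two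
factors.

The sum of `1/ν` is estimated by dyadic boxes. A box of volume less than a fixed multiple of `T` has
no nonzero dual point, and a larger one has at most about volume over `T`. Summing geometric series
gives `T^{-2r}` times one logarithm for each minimal `r_j` but one (`lattice_sum_le`).

The sum of `ν|f̂|²` splits over subsets `e` into sums of `|(D_e f)^|²`. A translate of the primal
lattice has at most `2 n D_P` points in the cube, so a Bessel inequality holds with constant `2 D_P`
(`sum_norm_ft_sq_le`). A Poincaré inequality bounds all `D_e f` by the top derivative
(`sum_integral_mixedDeriv_sq_le`). These estimates are proved for test functions and pass to `f` in
the limit. `constant_comparison` shows that the resulting numerical factors fit into the stated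
constant. -/

theorem IsAdmissible.pos (hP : IsAdmissible P ξ) : 0 < d := by
  rcases Nat.eq_zero_or_pos d with h | h
  · subst h
    exfalso
    have h1 : P = 1 := hP.monic.natDegree_eq_zero.1 hP.natDegree_eq
    have := hP.irreducible
    simp [h1] at this
  · exact h

theorem IsAdmissible.eval_eq_sum_modByMonic (hP : IsAdmissible P ξ) (q : ℤ[X]) (i : Fin d) :
    aeval (ξ i) q = ∑ j : Fin d, ((q %ₘ P).coeff j : ℝ) * ξ i ^ (j : ℕ) := by
  have h1 : aeval (ξ i) q = aeval (ξ i) (q %ₘ P) := by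
    conv_lhs => rw [← modByMonic_add_div q P]
    simp [hP.root i]
  have h2 : (q %ₘ P).natDegree < d := by
    rw [← hP.natDegree_eq]
    refine natDegree_modByMonic_lt q hP.monic fun h => ?_
    have := hP.pos
    rw [← hP.natDegree_eq, h] at this
    simp at this
  rw [h1, aeval_eq_sum_range' h2, Finset.sum_range]
  simp

/-- `P` is the minimal polynomial of each `ξ i` over ℚ, and a nonzero polynomial of degree less than
`d` is not a multiple of it. -/
theorem IsAdmissible.sum_ne_zero (hP : IsAdmissible P ξ) {c : Fin d → ℚ} (hc : c ≠ 0) (i : Fin d) :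
    ∑ j : Fin d, (c j : ℝ) * ξ i ^ (j : ℕ) ≠ 0 := by
  intro h
  set Q : ℚ[X] := P.map (Int.castRingHom ℚ) with hQ
  set g : ℚ[X] := ∑ j : Fin d, C (c j) * X ^ (j : ℕ) with hg
  have hmonic : Q.Monic := hP.monic.map _
  have hdegQ : Q.natDegree = d := by
    rw [hQ, hP.monic.natDegree_map, hP.natDegree_eq]
  have hroot : aeval (ξ i) Q = 0 := by
    have := hP.root i
    rw [hQ]
    rw [← this]
    exact aeval_map_algebraMap ℚ (ξ i) P
  have hmin : minpoly ℚ (ξ i) = Q :=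
    (minpoly.eq_of_irreducible_of_monic hP.irreducible hroot hmonic).symm
  have hgroot : aeval (ξ i) g = 0 := by
    rw [hg, map_sum, ← h]
    simp
  have hdvd : Q ∣ g := hmin ▸ minpoly.dvd ℚ (ξ i) hgroot
  have hg0 : g = 0 := by
    refine eq_zero_of_dvd_of_degree_lt hdvd ?_
    rw [degree_eq_natDegree hmonic.ne_zero, hdegQ, hg]
    exact (degree_sum_fin_lt c)
  apply hc
  funext j
  have := congrArg (fun p => coeff p (j : ℕ)) hg0
  simp only [hg, finsetSum_coeff, coeff_C_mul, coeff_X_pow, coeff_zero] at this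
  rw [Finset.sum_eq_single j] at this
  · simpa using this
  · intro b _ hb
    rw [if_neg, mul_zero]
    exact fun h => hb (Fin.ext h.symm)
  · simp

/-- The integer matrix of multiplication by `q` on `ℤ[x]/(P)` in the monomial basis. -/
noncomputable def mulMatrix (P q : ℤ[X]) (d : ℕ) : Matrix (Fin d) (Fin d) ℤ :=
  Matrix.of fun j b => ((X ^ (b : ℕ) * q) %ₘ P).coeff j

/-- Evaluation at the roots diagonalises multiplication by `q`. Hence the product and the sum of the
`q(ξ i)` are the determinant and the trace of an integer matrix. -/
theorem IsAdmissible.vandermonde_mul_mulMatrix (hP : IsAdmissible P ξ) (q : ℤ[X]) :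
    vandermonde ξ * (mulMatrix P q d).map (Int.cast : ℤ → ℝ) =
      diagonal (fun i => aeval (ξ i) q) * vandermonde ξ := by
  ext i b
  rw [diagonal_mul, mul_apply, vandermonde_apply]
  have := hP.eval_eq_sum_modByMonic (X ^ (b : ℕ) * q) i
  simp only [_root_.map_mul, _root_.map_pow, aeval_X] at this
  rw [mul_comm, this]
  refine Finset.sum_congr rfl fun j _ => ?_
  simp [mulMatrix, mul_comm, vandermonde_apply]

theorem IsAdmissible.det_ne_zero (hP : IsAdmissible P ξ) : (vandermonde ξ).det ≠ 0 :=
  det_vandermonde_ne_zero_iff.2 hP.injective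

theorem IsAdmissible.discr_pos (hP : IsAdmissible P ξ) : 0 < discr ξ :=
  abs_pos.2 hP.det_ne_zero

theorem det_map_intCast {m : Type*} [Fintype m] [DecidableEq m] (N : Matrix m m ℤ) :
    (N.map (Int.cast : ℤ → ℝ)).det = (N.det : ℝ) :=
  ((Int.castRingHom ℝ).map_det N).symm

theorem IsAdmissible.prod_eval_eq (hP : IsAdmissible P ξ) (q : ℤ[X]) :
    ∏ i, aeval (ξ i) q = ((mulMatrix P q d).det : ℝ) := by
  have h := congrArg det (hP.vandermonde_mul_mulMatrix q)
  rw [det_mul, det_mul, det_diagonal, det_map_intCast, mul_comm] at h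
  exact (mul_right_cancel₀ hP.det_ne_zero h).symm

theorem one_le_abs_of_int {x : ℝ} {m : ℤ} (h : x = m) (hx : x ≠ 0) : 1 ≤ |x| := by
  subst h
  rw [← Int.cast_abs]
  exact_mod_cast Int.one_le_abs (by exact_mod_cast hx)

theorem IsAdmissible.sum_eval_eq (hP : IsAdmissible P ξ) (q : ℤ[X]) :
    ∑ i, aeval (ξ i) q = ((mulMatrix P q d).trace : ℝ) := by
  have h := hP.vandermonde_mul_mulMatrix q
  have hu : IsUnit (vandermonde ξ).det := hP.det_ne_zero.isUnit
  have h2 : (mulMatrix P q d).map (Int.cast : ℤ → ℝ) =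
      (vandermonde ξ)⁻¹ * (diagonal (fun i => aeval (ξ i) q) * vandermonde ξ) := by
    rw [← h, nonsing_inv_mul_cancel_left _ _ hu]
  have h3 := congrArg trace h2
  rw [trace_mul_comm, Matrix.mul_assoc, mul_nonsing_inv _ hu, Matrix.mul_one, trace_diagonal] at h3
  rw [← h3]
  simp [trace]

/-- `VᵀV` is the Gram matrix of the trace form, so `det V ^ 2` is a nonzero integer. -/
theorem IsAdmissible.one_le_discr (hP : IsAdmissible P ξ) : 1 ≤ discr ξ := by
  have h : (vandermonde ξ).det ^ 2 =
      ((Matrix.of fun a b : Fin d => (mulMatrix P (X ^ ((a : ℕ) + b)) d).trace).det : ℝ) := by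
    rw [← det_map_intCast, sq]
    nth_rewrite 1 [← det_transpose]
    rw [← det_mul]
    congr 1
    ext a b
    simp only [mul_apply, transpose_apply, vandermonde_apply, map_apply, of_apply,
      ← hP.sum_eval_eq]
    simp [pow_add]
  have h1 := one_le_abs_of_int h (pow_ne_zero 2 hP.det_ne_zero)
  rw [abs_pow] at h1
  exact (one_le_sq_iff₀ (abs_nonneg _)).1 h1

theorem IsAdmissible.one_le_abs_prod_mulVec (hP : IsAdmissible P ξ) {k : Fin d → ℤ} (hk : k ≠ 0) :
    1 ≤ |∏ i, (vandermonde ξ *ᵥ fun j => (k j : ℝ)) i| := by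
  have h (i : Fin d) : (vandermonde ξ *ᵥ fun j => (k j : ℝ)) i =
      aeval (ξ i) (∑ j : Fin d, C (k j) * X ^ (j : ℕ)) := by
    simp [mulVec, dotProduct, vandermonde_apply, mul_comm]
  simp only [h]
  refine one_le_abs_of_int (hP.prod_eval_eq _) (Finset.prod_ne_zero_iff.2 fun i _ => ?_)
  have := hP.sum_ne_zero (c := fun j => (k j : ℚ))
    (fun h0 => hk (funext fun j => by simpa using congrFun h0 j)) i
  simpa using this

theorem IsAdmissible.one_le_abs_prod_dual (hP : IsAdmissible P ξ) {k : Fin d → ℤ} (hk : k ≠ 0)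
    {w : Fin d → ℝ} (hw : (vandermonde ξ)ᵀ *ᵥ w = fun j => (k j : ℝ)) :
    1 ≤ |∏ i, w i| * discr ξ ^ 2 := by
  -- The `(a, b)` entry of `Vᵀ diag(w) V` is the moment `∑ w_i ξ_i^(a+b)`. Reducing `X^(a+b)` modulo
  -- `P` makes it an integer combination of the first `d` moments, which are the `k j`.
  set N : Matrix (Fin d) (Fin d) ℤ :=
    Matrix.of fun a b => ∑ j : Fin d, ((X ^ ((a : ℕ) + b) : ℤ[X]) %ₘ P).coeff j * k j with hN
  have hNeq : N.map (Int.cast : ℤ → ℝ) = (vandermonde ξ)ᵀ * (diagonal w * vandermonde ξ) := by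
    ext a b
    simp only [hN, map_apply, of_apply, Int.cast_sum, Int.cast_mul, mul_apply (M := _ᵀ),
      diagonal_mul, transpose_apply, vandermonde_apply]
    have h1 (i : Fin d) : ξ i ^ (a : ℕ) * (w i * ξ i ^ (b : ℕ)) =
        ∑ j : Fin d, (((X ^ ((a : ℕ) + b) : ℤ[X]) %ₘ P).coeff j : ℝ) * (ξ i ^ (j : ℕ) * w i) := by
      have := hP.eval_eq_sum_modByMonic (X ^ ((a : ℕ) + b)) i
      simp only [_root_.map_pow, aeval_X] at this
      rw [mul_comm (w i), ← mul_assoc, ← pow_add, this, Finset.sum_mul]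
      simp only [mul_assoc]
    simp only [h1]
    rw [Finset.sum_comm]
    refine Finset.sum_congr rfl fun j _ => ?_
    rw [← Finset.mul_sum]
    congr 1
    have := congrFun hw j
    simp only [mulVec, dotProduct, transpose_apply, vandermonde_apply] at this
    exact this.symm
  have hdet : (∏ i, w i) * (vandermonde ξ).det ^ 2 = (N.det : ℝ) := by
    rw [← det_map_intCast, hNeq, det_mul, det_mul, det_diagonal, det_transpose]
    ring
  -- A singular integer matrix has a nonzero rational kernel vector `c`. Cancelling `Vᵀ` leaves `w_i
  -- (V c)_i = 0`; irreducibility gives `(V c)_i ≠ 0`, so `w = 0` and then `k = 0`.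
  have hne : (∏ i, w i) * (vandermonde ξ).det ^ 2 ≠ 0 := by
    rw [hdet]
    intro h0
    have h0' : (N.map (Int.cast : ℤ → ℚ)).det = 0 := by
      have := ((Int.castRingHom ℚ).map_det N).symm
      refine this.trans ?_
      have h0 : N.det = 0 := by exact_mod_cast h0
      simp [h0]
    obtain ⟨c, hc, hc0⟩ := exists_mulVec_eq_zero_iff.2 h0'
    have h1 : N.map (Int.cast : ℤ → ℝ) *ᵥ (fun j => (c j : ℝ)) = 0 := by
      funext a
      have := congrFun hc0 a
      simp only [mulVec, dotProduct, map_apply, Pi.zero_apply] at this ⊢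
      exact_mod_cast this
    have hu : IsUnit ((vandermonde ξ)ᵀ).det := by
      rw [det_transpose]; exact hP.det_ne_zero.isUnit
    rw [hNeq, ← mulVec_mulVec] at h1
    have h2 : (diagonal w * vandermonde ξ) *ᵥ (fun j => (c j : ℝ)) = 0 := by
      have h3 := congrArg (fun v => ((vandermonde ξ)ᵀ)⁻¹ *ᵥ v) h1
      simpa [mulVec_mulVec, nonsing_inv_mul_cancel_left _ _ hu] using h3
    have hw0 : w = 0 := by
      funext i
      have h3 := congrFun h2 i
      rw [← mulVec_mulVec, mulVec_diagonal] at h3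
      refine (mul_eq_zero.1 h3).resolve_right ?_
      have := hP.sum_ne_zero hc i
      simpa [mulVec, dotProduct, vandermonde_apply, mul_comm] using this
    apply hk
    funext j
    have := congrFun hw j
    simp [hw0] at this
    exact_mod_cast this.symm
  have := one_le_abs_of_int hdet hne
  rwa [abs_mul, abs_pow] at this

theorem cubatureMatrix_eq (n : ℕ) : ∃ s : ℝ, cubatureMatrix ξ n = s • vandermonde ξ ∧
    (0 < d → 0 ≤ s ∧ s ^ d = (n * discr ξ)⁻¹) := by
  refine ⟨(n : ℝ) ^ (-(1 / d : ℝ)) * |(vandermonde ξ).det| ^ (-(1 / d : ℝ)), ?_, fun hd => ⟨by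
    positivity, ?_⟩⟩
  · rw [cubatureMatrix, smul_smul]
  · have hd' : (d : ℝ) ≠ 0 := by exact_mod_cast hd.ne'
    have h (x : ℝ) (hx : 0 ≤ x) : (x ^ (-(1 / d : ℝ))) ^ d = x⁻¹ := by
      rw [← Real.rpow_natCast, ← Real.rpow_mul hx, neg_mul, one_div_mul_cancel hd',
        Real.rpow_neg_one]
    rw [mul_pow, h _ (by positivity), h _ (by positivity), mul_inv, discr]

theorem IsAdmissible.abs_det_cubatureMatrix (hP : IsAdmissible P ξ) (n : ℕ) :
    |(cubatureMatrix ξ n).det| = (n : ℝ)⁻¹ := by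
  obtain ⟨s, hs, h⟩ := cubatureMatrix_eq (ξ := ξ) n
  obtain ⟨-, h2⟩ := h hP.pos
  rw [hs, det_smul, Fintype.card_fin, h2, abs_mul, ← discr]
  have := hP.discr_pos
  rw [abs_of_nonneg (by positivity)]
  field_simp

theorem IsAdmissible.le_prod_cubatureMatrix (hP : IsAdmissible P ξ) (n : ℕ)
    {k : Fin d → ℤ} (hk : k ≠ 0) :
    (n * discr ξ)⁻¹ ≤ ∏ i, |(cubatureMatrix ξ n *ᵥ fun j => (k j : ℝ)) i| := by
  obtain ⟨s, hs, h⟩ := cubatureMatrix_eq (ξ := ξ) n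
  obtain ⟨h1, h2⟩ := h hP.pos
  have := hP.discr_pos
  simp only [hs, smul_mulVec, Pi.smul_apply, smul_eq_mul, abs_mul, Finset.prod_mul_distrib,
    Finset.prod_const, Finset.card_univ, Fintype.card_fin, abs_of_nonneg h1, h2]
  rw [← Finset.abs_prod]
  exact le_mul_of_one_le_right (by positivity) (hP.one_le_abs_prod_mulVec hk)

theorem IsAdmissible.le_prod_dual (hP : IsAdmissible P ξ) {n : ℕ} (hn : 1 ≤ n)
    {k : Fin d → ℤ} (hk : k ≠ 0) {z : Fin d → ℝ}
    (hz : (cubatureMatrix ξ n)ᵀ *ᵥ z = fun j => (k j : ℝ)) :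
    n / discr ξ ≤ ∏ i, |z i| := by
  obtain ⟨s, hs, h⟩ := cubatureMatrix_eq (ξ := ξ) n
  obtain ⟨h1, h2⟩ := h hP.pos
  have hD := hP.discr_pos
  have hn' : (0 : ℝ) < n := by exact_mod_cast hn
  have hw : (vandermonde ξ)ᵀ *ᵥ (s • z) = fun j => (k j : ℝ) := by
    rw [← hz, hs, mulVec_smul, transpose_smul, smul_mulVec]
  have := hP.one_le_abs_prod_dual hk hw
  simp only [Finset.abs_prod, Pi.smul_apply, smul_eq_mul, abs_mul, Finset.prod_mul_distrib,
    Finset.prod_const, Finset.card_univ, Fintype.card_fin, h2] at this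
  have h3 : (n * discr ξ)⁻¹ * (∏ i, |z i|) * discr ξ ^ 2 = (∏ i, |z i|) * (discr ξ / n) := by
    field_simp
  rw [abs_of_nonneg (by positivity), h3] at this
  rw [div_le_iff₀ hD]
  have := mul_le_mul_of_nonneg_left this hn'.le
  calc (n : ℝ) = n * 1 := by ring
    _ ≤ _ := this
    _ = _ := by field_simp

end NumberTheory

end Frolov

namespace Frolov

/-! ### Counting lattice points in boxes -/

section Counting

variable {d : ℕ}

/-- Points of a box whose coordinatewise distances have product at least `τ` are few. -/
theorem card_le_of_separated {ι : Type*} (F : Finset ι) (p : ι → Fin d → ℝ) (lo len : Fin d → ℝ)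
    (hlen : ∀ i, 0 < len i) {τ : ℝ} (hτ : 0 < τ) (j : Fin d)
    (hbox : ∀ k ∈ F, ∀ i, lo i ≤ p k i ∧ p k i < lo i + len i)
    (hsep : ∀ k ∈ F, ∀ l ∈ F, k ≠ l → τ ≤ ∏ i, |p k i - p l i|) :
    (F.card : ℝ) ≤ (∏ i, len i) / τ + 1 := by
  set W := ∏ i, len i with hW
  have hWpos : 0 < W := Finset.prod_pos fun i _ => hlen i
  -- Pigeonhole: cut the box into `N > W / τ` slabs across coordinate `j`. Two points in one slab
  -- would have distance product at most `W / N < τ`.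
  set N : ℕ := ⌊W / τ⌋₊ + 1 with hN
  have hNpos : (0 : ℝ) < N := by rw [hN]; positivity
  have hNlt : W / τ < N := by
    rw [hN]; push_cast; exact Nat.lt_floor_add_one _
  have hcard : F.card ≤ (Finset.range N).card := by
    refine Finset.card_le_card_of_injOn (fun k => ⌊(p k j - lo j) / len j * N⌋₊) ?_ ?_
    · intro k hk
      simp only [Finset.coe_range, Set.mem_Iio]
      obtain ⟨h1, h2⟩ := hbox k hk j
      have h3 : 0 ≤ (p k j - lo j) / len j * N :=
        mul_nonneg (div_nonneg (by linarith) (hlen j).le) hNpos.le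
      rw [Nat.floor_lt h3]
      refine mul_lt_of_lt_one_left hNpos ?_
      rw [div_lt_one (hlen j)]
      linarith
    · intro k hk l hl hkl
      by_contra hne
      have hs := hsep k hk l hl hne
      have hnn (m : ι) (hm : m ∈ F) : 0 ≤ (p m j - lo j) / len j * N :=
        mul_nonneg (div_nonneg (by linarith [(hbox m hm j).1]) (hlen j).le) hNpos.le
      have h1 : |(p k j - lo j) / len j * N - (p l j - lo j) / len j * N| < 1 := by
        have hkl' : ⌊(p k j - lo j) / len j * N⌋₊ = ⌊(p l j - lo j) / len j * N⌋₊ := hkl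
        have a1 := Nat.floor_le (hnn k hk)
        have a2 := Nat.lt_floor_add_one ((p k j - lo j) / len j * N)
        have b1 := Nat.floor_le (hnn l hl)
        have b2 := Nat.lt_floor_add_one ((p l j - lo j) / len j * N)
        rw [hkl'] at a1 a2
        rw [abs_lt]
        constructor <;> linarith
      have h2 : |p k j - p l j| < len j / N := by
        have : (p k j - lo j) / len j * N - (p l j - lo j) / len j * N =
            (p k j - p l j) * (N / len j) := by ring
        rw [this, abs_mul, abs_of_pos (div_pos hNpos (hlen j)), ← lt_div_iff₀
          (div_pos hNpos (hlen j)), one_div_div] at h1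
        exact h1
      have h3 : ∏ i, |p k i - p l i| ≤ len j / N * ∏ i ∈ Finset.univ.erase j, len i := by
        rw [← Finset.mul_prod_erase _ _ (Finset.mem_univ j)]
        refine mul_le_mul h2.le (Finset.prod_le_prod (fun _ _ => abs_nonneg _) fun i _ => ?_)
          (Finset.prod_nonneg fun _ _ => abs_nonneg _) (div_nonneg (hlen j).le hNpos.le)
        rw [abs_le]
        constructor <;> linarith [(hbox k hk i).1, (hbox k hk i).2, (hbox l hl i).1,
          (hbox l hl i).2]
      have h4 : len j / N * ∏ i ∈ Finset.univ.erase j, len i = W / N := by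
        rw [hW, ← Finset.mul_prod_erase _ _ (Finset.mem_univ j)]
        ring
      have h5 : W / N < τ := by
        rw [div_lt_iff₀ hNpos]
        rwa [div_lt_iff₀ hτ, mul_comm] at hNlt
      linarith
  rw [Finset.card_range] at hcard
  calc (F.card : ℝ) ≤ N := by exact_mod_cast hcard
    _ ≤ W / τ + 1 := by
      rw [hN]; push_cast
      linarith [Nat.floor_le (div_pos hWpos hτ).le]

/-- If `φ` maps `ℤ^d` additively to `ℝ^d` and all nonzero image points have coordinate product at
least `τ`, then a translate of the lattice has few points in a box. -/
theorem card_lattice_le (φ : (Fin d → ℤ) →+ (Fin d → ℝ)) {τ : ℝ} (hτ : 0 < τ)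
    (hφ : ∀ k, k ≠ 0 → τ ≤ ∏ i, |φ k i|) (j : Fin d) (x lo len : Fin d → ℝ)
    (hlen : ∀ i, 0 < len i) (F : Finset (Fin d → ℤ))
    (hbox : ∀ k ∈ F, ∀ i, lo i ≤ x i + φ k i ∧ x i + φ k i < lo i + len i) :
    (F.card : ℝ) ≤ (∏ i, len i) / τ + 1 := by
  refine card_le_of_separated F (fun k => x + φ k) lo len hlen hτ j hbox fun k _ l _ hkl => ?_
  have := hφ (k - l) (sub_ne_zero.2 hkl)
  simpa using this

/-- The nonzero lattice points in a centered box. -/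
theorem card_lattice_ne_zero_le (φ : (Fin d → ℤ) →+ (Fin d → ℝ)) {τ : ℝ} (hτ : 0 < τ)
    (hφ : ∀ k, k ≠ 0 → τ ≤ ∏ i, |φ k i|) (j : Fin d) (len : Fin d → ℝ)
    (hlen : ∀ i, 0 < len i) (F : Finset (Fin d → ℤ)) (hF : ∀ k ∈ F, k ≠ 0)
    (hbox : ∀ k ∈ F, ∀ i, |φ k i| < len i) :
    (F.card : ℝ) ≤ 2 ^ d * (∏ i, len i) / τ := by
  have h0 : (0 : Fin d → ℤ) ∉ F := fun h => hF 0 h rfl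
  -- The origin also lies in the box. Adding it to `F` uses up the `+ 1` of the general count, so no
  -- additive constant remains.
  have := card_lattice_le φ hτ hφ j 0 (fun i => - len i) (fun i => 2 * len i)
    (fun i => by linarith [hlen i]) (insert 0 F) (by
      intro k hk i
      rcases Finset.mem_insert.1 hk with rfl | hk
      · simpa using ⟨(hlen i).le, by linarith [hlen i]⟩
      · have := abs_lt.1 (hbox k hk i)
        simp only [Pi.zero_apply, zero_add]
        constructor <;> linarith)
  rw [Finset.card_insert_of_notMem h0, Finset.prod_mul_distrib] at this
  push_cast at this
  simpa using this

end Counting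

/-! ### Multi-indexed geometric sums over `∑ m_i ≥ L` -/

section DyadicSums

variable {d : ℕ}

theorem exists_le_sum_eq (m : Fin d → ℕ) {L : ℕ} (h : L ≤ ∑ i, m i) :
    ∃ a : Fin d → ℕ, a ≤ m ∧ ∑ i, a i = L := by
  induction L with
  | zero => exact ⟨0, fun _ => Nat.zero_le _, by simp⟩
  | succ L ih =>
    obtain ⟨a, ha, hs⟩ := ih (by omega)
    have : ∃ i, a i < m i := by
      by_contra! hc
      have := Finset.sum_le_sum fun i (_ : i ∈ Finset.univ) => hc i
      omega
    obtain ⟨i, hi⟩ := this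
    refine ⟨a + Pi.single i 1, fun j => ?_, ?_⟩
    · by_cases hj : j = i
      · subst hj; simpa using hi
      · simpa [hj] using ha j
    · simp [Finset.sum_add_distrib, hs]

theorem sum_pow_le_inv {y : ℝ} (h0 : 0 ≤ y) (h1 : y < 1) (N : ℕ) :
    ∑ a ∈ Finset.range N, y ^ a ≤ (1 - y)⁻¹ := by
  rw [← tsum_geometric_of_lt_one h0 h1]
  exact (summable_geometric_of_lt_one h0 h1).sum_le_tsum _ fun _ _ => by positivity

/-- As `q j = 1`, coordinate `j` does not affect the summand, and the constraint determines it from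
the others. Setting it to zero is therefore injective and leaves a product over `i ≠ j`. This is
where one logarithmic factor is saved. -/
theorem sum_filter_sum_eq_le (q : Fin d → ℝ) (hq : ∀ i, 0 ≤ q i) {j : Fin d} (hj : q j = 1)
    (L : ℕ) :
    ∑ a ∈ (Fintype.piFinset fun _ : Fin d => Finset.range (L + 1)) with ∑ i, a i = L,
        ∏ i, q i ^ a i ≤
      ∏ i ∈ Finset.univ.erase j, ∑ a ∈ Finset.range (L + 1), q i ^ a := by
  classical
  have h1 : ∏ i ∈ Finset.univ.erase j, ∑ a ∈ Finset.range (L + 1), q i ^ a =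
      ∏ i, ∑ a ∈ (if i = j then {0} else Finset.range (L + 1)), q i ^ a := by
    rw [← Finset.mul_prod_erase _ _ (Finset.mem_univ j)]
    simp only [if_true, Finset.sum_singleton, pow_zero, one_mul]
    refine Finset.prod_congr rfl fun i hi => ?_
    rw [if_neg (Finset.ne_of_mem_erase hi)]
  rw [h1, Finset.prod_univ_sum]
  have h2 (a : Fin d → ℕ) : ∏ i, q i ^ a i = ∏ i, q i ^ (Function.update a j 0) i := by
    refine Finset.prod_congr rfl fun i _ => ?_
    by_cases h : i = j
    · subst h; simp [hj]
    · simp [h]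
  rw [Finset.sum_congr rfl fun a _ => h2 a]
  have hinj : Set.InjOn (fun a : Fin d → ℕ => Function.update a j 0)
      ((Fintype.piFinset fun _ : Fin d => Finset.range (L + 1)).filter fun a => ∑ i, a i = L) := by
    intro a ha b hb hab
    have hab' (i : Fin d) (hi : i ≠ j) : a i = b i := by
      have := congrFun hab i
      simpa [hi] using this
    have ha' : ∑ i, a i = L := (Finset.mem_filter.1 ha).2
    have hb' : ∑ i, b i = L := (Finset.mem_filter.1 hb).2
    rw [← Finset.add_sum_erase _ _ (Finset.mem_univ j)] at ha' hb'
    have h3 : ∑ i ∈ Finset.univ.erase j, a i = ∑ i ∈ Finset.univ.erase j, b i :=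
      Finset.sum_congr rfl fun i hi => hab' i (Finset.ne_of_mem_erase hi)
    funext i
    by_cases hi : i = j
    · subst hi; omega
    · exact hab' i hi
  rw [← Finset.sum_image (f := fun c : Fin d → ℕ => ∏ i, q i ^ c i) hinj]
  refine Finset.sum_le_sum_of_subset_of_nonneg ?_ fun c _ _ =>
    Finset.prod_nonneg fun i _ => pow_nonneg (hq i) _
  intro c hc
  obtain ⟨a, ha, rfl⟩ := Finset.mem_image.1 hc
  rw [Fintype.mem_piFinset]
  intro i
  by_cases hi : i = j
  · subst hi; simp
  · simpa [hi] using Fintype.mem_piFinset.1 (Finset.mem_filter.1 ha).1 i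

/-- Each `m` of size at least `L` is written as `a + b` with `a` of size exactly `L`, an injective
choice. The `a`-part carries `x ^ L` times a sum of powers of `q`; the `b`-part runs over a product
of full geometric series. -/
theorem dyadic_sum_le (y q : Fin d → ℝ) {x : ℝ} (hx : 0 ≤ x) (hq : ∀ i, 0 ≤ q i)
    (hy : ∀ i, y i = x * q i) (hy1 : ∀ i, y i < 1) {j : Fin d} (hj : q j = 1) (L N : ℕ) :
    ∑ m ∈ (Fintype.piFinset fun _ : Fin d => Finset.range N) with L ≤ ∑ i, m i, ∏ i, y i ^ m i ≤
      x ^ L * (∏ i ∈ Finset.univ.erase j, ∑ a ∈ Finset.range (L + 1), q i ^ a) *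
        ∏ i, (1 - y i)⁻¹ := by
  classical
  have hy0 (i : Fin d) : 0 ≤ y i := by rw [hy]; exact mul_nonneg hx (hq i)
  choose! α hα1 hα2 using fun (m : Fin d → ℕ) (h : L ≤ ∑ i, m i) => exists_le_sum_eq m h
  set S := (Fintype.piFinset fun _ : Fin d => Finset.range N).filter fun m => L ≤ ∑ i, m i
  set SA := (Fintype.piFinset fun _ : Fin d => Finset.range (L + 1)).filter fun a => ∑ i, a i = L
  set SB := Fintype.piFinset fun _ : Fin d => Finset.range N
  have hS (m : Fin d → ℕ) (hm : m ∈ S) : L ≤ ∑ i, m i := (Finset.mem_filter.1 hm).2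
  have hrec (m : Fin d → ℕ) (hm : m ∈ S) : α m + (m - α m) = m := by
    funext i
    exact Nat.add_sub_of_le (hα1 m (hS m hm) i)
  have hinj : Set.InjOn (fun m : Fin d → ℕ => (α m, m - α m)) S := by
    intro m hm m' hm' h
    simp only [Prod.mk.injEq] at h
    rw [← hrec m hm, ← hrec m' hm', h.2, h.1]
  have h1 : ∑ m ∈ S, ∏ i, y i ^ m i =
      ∑ p ∈ S.image fun m => (α m, m - α m), ∏ i, y i ^ (p.1 + p.2) i := by
    rw [Finset.sum_image hinj]
    refine Finset.sum_congr rfl fun m hm => ?_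
    rw [hrec m hm]
  have hsub : (S.image fun m => (α m, m - α m)) ⊆ SA ×ˢ SB := by
    intro p hp
    obtain ⟨m, hm, rfl⟩ := Finset.mem_image.1 hp
    rw [Finset.mem_product]
    refine ⟨Finset.mem_filter.2 ⟨?_, hα2 m (hS m hm)⟩, ?_⟩
    · rw [Fintype.mem_piFinset]
      intro i
      have := Finset.single_le_sum (f := α m) (fun _ _ => Nat.zero_le _) (Finset.mem_univ i)
      rw [hα2 m (hS m hm)] at this
      exact Finset.mem_range.2 (Nat.lt_succ_of_le this)
    · rw [Fintype.mem_piFinset]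
      intro i
      have h2 := Fintype.mem_piFinset.1 (Finset.mem_filter.1 hm).1 i
      simp only [Finset.mem_range, Pi.sub_apply] at h2 ⊢
      omega
  rw [h1]
  refine (Finset.sum_le_sum_of_subset_of_nonneg hsub fun _ _ _ =>
    Finset.prod_nonneg fun i _ => pow_nonneg (hy0 i) _).trans ?_
  simp only [Pi.add_apply, pow_add, Finset.prod_mul_distrib]
  rw [Finset.sum_product]
  simp only [← Finset.mul_sum, ← Finset.sum_mul]
  refine mul_le_mul ?_ ?_ (Finset.sum_nonneg fun _ _ => Finset.prod_nonneg fun i _ =>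
    pow_nonneg (hy0 i) _) (mul_nonneg (pow_nonneg hx _) (Finset.prod_nonneg fun i _ =>
    Finset.sum_nonneg fun _ _ => pow_nonneg (hq i) _))
  · have h3 : ∑ a ∈ SA, ∏ i, y i ^ a i = x ^ L * ∑ a ∈ SA, ∏ i, q i ^ a i := by
      rw [Finset.mul_sum]
      refine Finset.sum_congr rfl fun a ha => ?_
      simp only [hy, mul_pow, Finset.prod_mul_distrib, Finset.prod_pow_eq_pow_sum]
      rw [(Finset.mem_filter.1 ha).2]
    rw [h3]
    exact mul_le_mul_of_nonneg_left (sum_filter_sum_eq_le q hq hj L) (pow_nonneg hx _)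
  · rw [← Finset.prod_univ_sum (fun _ => Finset.range N) fun i a => y i ^ a]
    exact Finset.prod_le_prod (fun i _ => Finset.sum_nonneg fun _ _ => pow_nonneg (hy0 i) _)
      fun i _ => sum_pow_le_inv (hy0 i) (hy1 i) N

end DyadicSums

end Frolov

namespace Frolov

/-! ### The sum of inverse weights over the dual lattice -/

section LatticeSum

variable {d : ℕ}

/-- The exponent of the smallest power of two which exceeds `t`. -/
noncomputable def dyadicExp (t : ℝ) : ℕ := Nat.size ⌊t⌋₊

theorem lt_two_pow_dyadicExp (t : ℝ) : t < 2 ^ dyadicExp t := by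
  calc t < ⌊t⌋₊ + 1 := Nat.lt_floor_add_one t
    _ ≤ 2 ^ dyadicExp t := by exact_mod_cast Nat.lt_size_self ⌊t⌋₊

theorem dyadicExp_le {t : ℝ} {s : ℕ} (h : t < 2 ^ s) : dyadicExp t ≤ s := by
  rw [dyadicExp, Nat.size_le]
  rcases le_or_gt 0 t with h0 | h0
  · rw [Nat.floor_lt h0]; exact_mod_cast h
  · rw [Nat.floor_of_nonpos h0.le]; positivity

theorem two_pow_le_of_lt_dyadicExp {t : ℝ} {s : ℕ} (h : s < dyadicExp t) : 2 ^ s ≤ t := by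
  by_contra! hc
  exact absurd (dyadicExp_le hc) (not_le.2 h)

/-- The factor `3 / 2` works because `3 / 2 * log 2 > 1`, while `dyadicExp t - 1` is at most `log t
/ log 2` if `dyadicExp t > 0`. -/
theorem dyadicExp_add_one_le {t : ℝ} (h : 1 ≤ 2 + Real.log t) :
    (dyadicExp t : ℝ) + 1 ≤ 3 / 2 * (2 + Real.log t) := by
  rcases Nat.eq_zero_or_pos (dyadicExp t) with h0 | h0
  · rw [h0]; norm_num; linarith
  · have h1 : (2 : ℝ) ^ (dyadicExp t - 1) ≤ t := two_pow_le_of_lt_dyadicExp (by omega)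
    have h2 := Real.log_le_log (by positivity) h1
    rw [Real.log_pow, Nat.cast_sub h0] at h2
    have h3 := Real.log_two_gt_d9
    have h4 : (1 : ℝ) ≤ dyadicExp t := by exact_mod_cast h0
    push_cast at h2
    nlinarith

/-- The factor `2π ≥ 2` pays for rounding `|t|` up to the next power of two; the summand `1` covers
exponent zero. -/
theorem two_pow_dyadicExp_pow_le (t : ℝ) (r : ℕ) :
    ((2 : ℝ) ^ dyadicExp |t|) ^ (2 * r) ≤ 1 + (2 * Real.pi * t) ^ (2 * r) := by
  have h0 : (2 * Real.pi * t) ^ (2 * r) = |2 * Real.pi * t| ^ (2 * r) :=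
    (Even.pow_abs ⟨r, by ring⟩ _).symm
  rcases Nat.eq_zero_or_pos (dyadicExp |t|) with h | h
  · rw [h, h0, pow_zero, one_pow]
    exact le_add_of_nonneg_right (by positivity)
  · have h1 : (2 : ℝ) ^ (dyadicExp |t| - 1) ≤ |t| := two_pow_le_of_lt_dyadicExp (by omega)
    have h2 : (2 : ℝ) ^ dyadicExp |t| ≤ |2 * Real.pi * t| := by
      rw [abs_mul (2 * Real.pi), abs_of_pos (by positivity : 0 < 2 * Real.pi)]
      have h3 : (2 : ℝ) ^ dyadicExp |t| = 2 * 2 ^ (dyadicExp |t| - 1) := by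
        rw [← pow_succ']; congr 1; omega
      rw [h3]
      nlinarith [Real.pi_gt_three, abs_nonneg t]
    rw [h0]
    have := pow_le_pow_left₀ (by positivity) h2 (2 * r)
    linarith

/-- Points are grouped by the dyadic exponents `m` of their coordinates. Then `T ≤ ∏|φ k i| < 2^(∑
m_i)` forces `∑ m_i ≥ dyadicExp T`. A class has at most `2^d 2^(∑ m_i) / T` points, each of weight
at most `∏ 4^(-r_i m_i)`, which gives the ratios `2 * 4^(-r_i)`. -/
theorem lattice_sum_le_dyadic (φ : (Fin d → ℤ) →+ (Fin d → ℝ)) {T : ℝ} (hT : 0 < T)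
    (hφ : ∀ k, k ≠ 0 → T ≤ ∏ i, |φ k i|) (j : Fin d) (r : Fin d → ℕ)
    (F : Finset (Fin d → ℤ)) (hF : ∀ k ∈ F, k ≠ 0) :
    ∃ N : ℕ, ∑ k ∈ F, ∏ i, (1 + (2 * Real.pi * φ k i) ^ (2 * r i))⁻¹ ≤
      2 ^ d / T * ∑ m ∈ (Fintype.piFinset fun _ : Fin d => Finset.range N) with
        dyadicExp T ≤ ∑ i, m i, ∏ i, (2 * (1 / 4 : ℝ) ^ r i) ^ m i := by
  classical
  set μ : (Fin d → ℤ) → Fin d → ℕ := fun k i => dyadicExp |φ k i| with hμ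
  set N : ℕ := (F.sup fun k => Finset.univ.sup (μ k)) + 1 with hN
  refine ⟨N, ?_⟩
  set S := (Fintype.piFinset fun _ : Fin d => Finset.range N).filter
    fun m => dyadicExp T ≤ ∑ i, m i with hS
  have hmap : ∀ k ∈ F, μ k ∈ S := by
    intro k hk
    refine Finset.mem_filter.2 ⟨?_, ?_⟩
    · rw [Fintype.mem_piFinset]
      intro i
      rw [Finset.mem_range, hN, Nat.lt_succ_iff]
      exact (Finset.le_sup (f := μ k) (Finset.mem_univ i)).trans
        (Finset.le_sup (f := fun k => Finset.univ.sup (μ k)) hk)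
    · refine dyadicExp_le ((hφ k (hF k hk)).trans_lt ?_)
      rw [← Finset.prod_pow_eq_pow_sum]
      have hpos : ∀ i, 0 < |φ k i| := by
        intro i
        refine (abs_nonneg _).lt_of_ne' fun h0 => ?_
        have := hφ k (hF k hk)
        rw [Finset.prod_eq_zero (Finset.mem_univ i) h0] at this
        linarith
      exact Finset.prod_lt_prod_of_nonempty (fun i _ => hpos i)
        (fun i _ => lt_two_pow_dyadicExp _) ⟨j, Finset.mem_univ j⟩
  rw [← Finset.sum_fiberwise_of_maps_to hmap, Finset.mul_sum]
  refine Finset.sum_le_sum fun m _ => ?_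
  have hcard := card_lattice_ne_zero_le φ hT hφ j (fun i => 2 ^ m i) (fun i => by positivity)
    (F.filter fun k => μ k = m) (fun k hk => hF k (Finset.mem_filter.1 hk).1) (by
      intro k hk i
      rw [← (Finset.mem_filter.1 hk).2]
      exact lt_two_pow_dyadicExp _)
  have hw : ∀ k ∈ F.filter (fun k => μ k = m),
      ∏ i, (1 + (2 * Real.pi * φ k i) ^ (2 * r i))⁻¹ ≤ ∏ i, (((2 : ℝ) ^ m i) ^ (2 * r i))⁻¹ := by
    intro k hk
    refine Finset.prod_le_prod (fun i _ => ?_) fun i _ => ?_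
    · have : 0 ≤ (2 * Real.pi * φ k i) ^ (2 * r i) := Even.pow_nonneg ⟨r i, by ring⟩ _
      positivity
    · rw [← (Finset.mem_filter.1 hk).2]
      exact inv_anti₀ (by positivity) (two_pow_dyadicExp_pow_le _ _)
  refine (Finset.sum_le_card_nsmul _ _ _ hw).trans ?_
  rw [nsmul_eq_mul]
  refine (mul_le_mul_of_nonneg_right hcard (by positivity)).trans (le_of_eq ?_)
  have h1 : ∏ i, (2 * (1 / 4 : ℝ) ^ r i) ^ m i =
      (∏ i, (2 : ℝ) ^ m i) * ∏ i, (((2 : ℝ) ^ m i) ^ (2 * r i))⁻¹ := by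
    rw [← Finset.prod_mul_distrib]
    refine Finset.prod_congr rfl fun i _ => ?_
    rw [mul_pow, ← pow_mul, ← pow_mul, ← inv_pow, mul_comm (r i)]
    congr 1
    rw [show (1 / 4 : ℝ) = (2⁻¹) ^ 2 by norm_num, ← pow_mul]
    congr 1
    ring
  rw [h1]
  ring

theorem leastSmoothness_le (r : Fin d → ℕ) (i : Fin d) : leastSmoothness r ≤ r i :=
  Nat.sInf_le ⟨i, rfl⟩

theorem exists_eq_leastSmoothness (r : Fin d → ℕ) (i : Fin d) : ∃ j, r j = leastSmoothness r :=
  Nat.sInf_mem (s := Set.range r) ⟨r i, i, rfl⟩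

theorem nextSmoothness_le {r : Fin d → ℕ} {i : Fin d} (h : r i ≠ leastSmoothness r) :
    nextSmoothness r ≤ r i :=
  Nat.sInf_le ⟨⟨i, rfl⟩, h⟩

theorem leastSmoothness_lt_nextSmoothness {r : Fin d → ℕ} {i : Fin d}
    (h : r i ≠ leastSmoothness r) : leastSmoothness r < nextSmoothness r := by
  obtain ⟨⟨j, hj⟩, h2⟩ := Nat.sInf_mem (s := {m | (∃ j, r j = m) ∧ m ≠ leastSmoothness r})
    ⟨r i, ⟨i, rfl⟩, h⟩
  refine lt_of_le_of_ne ?_ (Ne.symm h2)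
  rw [nextSmoothness, ← hj]
  exact leastSmoothness_le r j

theorem prod_ite_leastSmoothness (r : Fin d → ℕ) (a b : ℝ) :
    ∏ i, (if r i = leastSmoothness r then a else b) = a ^ numMin r * b ^ (d - numMin r) := by
  rw [Finset.prod_ite, Finset.prod_const, Finset.prod_const, numMin]
  congr 2
  have := Finset.card_filter_add_card_filter_not (s := Finset.univ)
    (fun i => r i = leastSmoothness r)
  rw [Finset.card_univ, Fintype.card_fin] at this
  omega

theorem one_le_numMin {r : Fin d → ℕ} {j : Fin d} (hj : r j = leastSmoothness r) :
    1 ≤ numMin r :=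
  Finset.card_pos.2 ⟨j, by simpa using hj⟩

theorem prod_erase_ite_leastSmoothness {r : Fin d → ℕ} {j : Fin d} (hj : r j = leastSmoothness r)
    {a : ℝ} (ha : a ≠ 0) (b : ℝ) :
    ∏ i ∈ Finset.univ.erase j, (if r i = leastSmoothness r then a else b) =
      a ^ (numMin r - 1) * b ^ (d - numMin r) := by
  have h := prod_ite_leastSmoothness r a b
  rw [← Finset.mul_prod_erase _ _ (Finset.mem_univ j), if_pos hj] at h
  refine mul_left_cancel₀ ha (h.trans ?_)
  rw [← mul_assoc, ← pow_succ', Nat.sub_add_cancel (one_le_numMin hj)]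

/-- In `dyadic_sum_le` take `x = 2 * 4^(-ρ)` and `q_i = 4^(-(r_i - ρ))`, with `ρ` the least
smoothness. Minimal indices have `q_i = 1` and contribute `dyadicExp T + 1` each, except for the one
already removed; the others contribute convergent series. -/
theorem lattice_sum_le (φ : (Fin d → ℤ) →+ (Fin d → ℝ)) {T : ℝ} (hT : 0 < T)
    (hφ : ∀ k, k ≠ 0 → T ≤ ∏ i, |φ k i|) {j : Fin d} {r : Fin d → ℕ}
    (hj : r j = leastSmoothness r) (hr : ∀ i, 1 ≤ r i)
    (F : Finset (Fin d → ℤ)) (hF : ∀ k ∈ F, k ≠ 0) :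
    ∑ k ∈ F, ∏ i, (1 + (2 * Real.pi * φ k i) ^ (2 * r i))⁻¹ ≤
      2 ^ d * (T⁻¹) ^ (2 * leastSmoothness r) * ((dyadicExp T : ℝ) + 1) ^ (numMin r - 1) *
        ((1 - (1 / 4 : ℝ) ^ (nextSmoothness r - leastSmoothness r))⁻¹) ^ (d - numMin r) *
        ((1 - 2 * (1 / 4 : ℝ) ^ leastSmoothness r)⁻¹) ^ numMin r * (8 / 7) ^ (d - numMin r) := by
  set ρ := leastSmoothness r with hρ
  have hρ1 : 1 ≤ ρ := hj ▸ hr j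
  set x : ℝ := 2 * (1 / 4 : ℝ) ^ ρ with hx
  have hx0 : 0 < x := by positivity
  obtain ⟨N, hN⟩ := lattice_sum_le_dyadic φ hT hφ j r F hF
  set q : Fin d → ℝ := fun i => (1 / 4 : ℝ) ^ (r i - ρ) with hq
  have hpow4 {s : ℕ} (h : 1 ≤ s) : (1 / 4 : ℝ) ^ s ≤ 1 / 4 := by
    simpa using pow_le_pow_of_le_one (by norm_num : (0 : ℝ) ≤ 1 / 4) (by norm_num) h
  have hdy := dyadic_sum_le (fun i => 2 * (1 / 4 : ℝ) ^ r i) q (x := x) hx0.le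
    (fun i => by positivity) (fun i => by
      simp only [hx, hq, mul_assoc]
      rw [← pow_add, Nat.add_sub_of_le (leastSmoothness_le r i)])
    (fun i => by have := hpow4 (hr i); linarith) (j := j) (by simp [hq, hj]) (dyadicExp T) N
  refine hN.trans ((mul_le_mul_of_nonneg_left hdy (by positivity)).trans ?_)
  -- Needed only if some `r i` exceeds `ρ`. If all are equal, the truncated difference is `0`, but
  -- then the corresponding factor has exponent `0` and equals `1`.
  have hb0 (i : Fin d) (hi : r i ≠ ρ) :
      (1 / 4 : ℝ) ^ (nextSmoothness r - ρ) < 1 := by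
    have := hpow4 (s := nextSmoothness r - ρ) (by
      have := leastSmoothness_lt_nextSmoothness hi; omega)
    linarith
  have hA : ∏ i ∈ Finset.univ.erase j, ∑ a ∈ Finset.range (dyadicExp T + 1), q i ^ a ≤
      ((dyadicExp T : ℝ) + 1) ^ (numMin r - 1) *
        ((1 - (1 / 4 : ℝ) ^ (nextSmoothness r - ρ))⁻¹) ^ (d - numMin r) := by
    rw [← prod_erase_ite_leastSmoothness hj (by positivity)]
    refine Finset.prod_le_prod (fun i _ => by positivity) fun i _ => ?_
    split_ifs with hi
    · simp [hq, hi, hρ]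
    · have hqi : q i ≤ (1 / 4 : ℝ) ^ (nextSmoothness r - ρ) :=
        pow_le_pow_of_le_one (by norm_num) (by norm_num)
          (Nat.sub_le_sub_right (nextSmoothness_le hi) _)
      have hlt := hb0 i hi
      refine (sum_pow_le_inv (by positivity) (hqi.trans_lt hlt) _).trans ?_
      exact inv_anti₀ (by linarith) (by linarith)
  have hB : ∏ i, (1 - 2 * (1 / 4 : ℝ) ^ r i)⁻¹ ≤
      ((1 - x)⁻¹) ^ numMin r * (8 / 7) ^ (d - numMin r) := by
    rw [← prod_ite_leastSmoothness r]
    refine Finset.prod_le_prod (fun i _ => ?_) fun i _ => ?_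
    · have := hpow4 (hr i)
      exact inv_nonneg.2 (by linarith)
    · split_ifs with hi
      · rw [hi]
      -- A non-minimal exponent is at least `2`, so `2 * 4^(-r_i) ≤ 1 / 8`; hence the `8 / 7`.
      · have h2 : 2 ≤ r i := by
          have := leastSmoothness_le r i; omega
        have h3 : (1 / 4 : ℝ) ^ r i ≤ (1 / 4) ^ 2 :=
          pow_le_pow_of_le_one (by norm_num) (by norm_num) h2
        refine (inv_anti₀ (by norm_num : (0 : ℝ) < 7 / 8) (by norm_num at h3 ⊢; linarith)).trans ?_
        norm_num
  -- Here `x = 2^(-(2ρ - 1))` and `2^(dyadicExp T) > T`. The factor `T` on the right cancels the `1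
  -- / T` from the point count.
  have hxL : x ^ dyadicExp T ≤ T * (T⁻¹) ^ (2 * ρ) := by
    have h1 : x ^ dyadicExp T = (((2 : ℝ) ^ dyadicExp T)⁻¹) ^ (2 * ρ - 1) := by
      have h2 : x = (2⁻¹) ^ (2 * ρ - 1) := by
        have : (1 / 4 : ℝ) ^ ρ = 2⁻¹ ^ (2 * ρ) := by
          rw [pow_mul]; norm_num
        rw [hx, this, show 2 * ρ = (2 * ρ - 1) + 1 by omega, pow_succ,
          Nat.add_sub_cancel]
        ring
      rw [h2, ← inv_pow, ← pow_mul, ← pow_mul, mul_comm]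
    have h2 : T * (T⁻¹) ^ (2 * ρ) = (T⁻¹) ^ (2 * ρ - 1) := by
      conv_lhs => rw [show 2 * ρ = (2 * ρ - 1) + 1 by omega, pow_succ]
      field_simp
    rw [h1, h2]
    exact pow_le_pow_left₀ (by positivity) (inv_anti₀ hT (lt_two_pow_dyadicExp T).le) _
  have hAnn : 0 ≤ ∏ i ∈ Finset.univ.erase j, ∑ a ∈ Finset.range (dyadicExp T + 1), q i ^ a :=
    Finset.prod_nonneg fun i _ => Finset.sum_nonneg fun _ _ => by positivity
  have hBnn : 0 ≤ ∏ i, (1 - 2 * (1 / 4 : ℝ) ^ r i)⁻¹ :=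
    Finset.prod_nonneg fun i _ => by
      have := hpow4 (hr i)
      exact inv_nonneg.2 (by linarith)
  calc _ ≤ 2 ^ d / T * ((T * (T⁻¹) ^ (2 * ρ)) * (((dyadicExp T : ℝ) + 1) ^ (numMin r - 1) *
        ((1 - (1 / 4 : ℝ) ^ (nextSmoothness r - ρ))⁻¹) ^ (d - numMin r)) *
        (((1 - x)⁻¹) ^ numMin r * (8 / 7) ^ (d - numMin r))) := by
        refine mul_le_mul_of_nonneg_left ?_ (by positivity)
        refine mul_le_mul ?_ hB hBnn ?_
        · exact mul_le_mul hxL hA hAnn (by positivity)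
        · exact mul_nonneg (by positivity) (hAnn.trans hA)
    _ = _ := by
        field_simp

end LatticeSum

end Frolov

namespace Frolov

open MeasureTheory
open scoped ContDiff

/-! ### Mixed derivatives, integration by parts and the Poincaré inequality -/

section Calculus

variable {d : ℕ}

/-- Smooth functions with compact support. -/
structure SmoothCompact (φ : (Fin d → ℝ) → ℝ) : Prop where
  contDiff : ContDiff ℝ ∞ φ
  hasCompactSupport : HasCompactSupport φ

variable {φ ψ : (Fin d → ℝ) → ℝ}

theorem partialDeriv_eq_fderiv (h : ContDiff ℝ ∞ φ) (i : Fin d) :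
    partialDeriv i φ = fun x => fderiv ℝ φ x (Pi.single i 1) :=
  funext fun _ => ((h.differentiable (by simp)).differentiableAt).lineDeriv_eq_fderiv

theorem contDiff_partialDeriv (h : ContDiff ℝ ∞ φ) (i : Fin d) :
    ContDiff ℝ ∞ (partialDeriv i φ) := by
  rw [partialDeriv_eq_fderiv h]
  exact (h.fderiv_right (m := ∞) (by simp)).clm_apply contDiff_const

theorem tsupport_partialDeriv_subset (h : ContDiff ℝ ∞ φ) (i : Fin d) :
    tsupport (partialDeriv i φ) ⊆ tsupport φ := by
  rw [partialDeriv_eq_fderiv h]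
  exact tsupport_fderiv_apply_subset ℝ _

namespace SmoothCompact

theorem partialDeriv (h : SmoothCompact φ) (i : Fin d) : SmoothCompact (partialDeriv i φ) where
  contDiff := contDiff_partialDeriv h.contDiff i
  hasCompactSupport := h.hasCompactSupport.mono'
    ((subset_tsupport _).trans (tsupport_partialDeriv_subset h.contDiff i))

theorem mul (h : SmoothCompact φ) (hψ : ContDiff ℝ ∞ ψ) : SmoothCompact fun x => ψ x * φ x where
  contDiff := hψ.mul h.contDiff
  hasCompactSupport := h.hasCompactSupport.mul_left

theorem sub (h : SmoothCompact φ) (hψ : SmoothCompact ψ) : SmoothCompact fun x => φ x - ψ x where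
  contDiff := h.contDiff.sub hψ.contDiff
  hasCompactSupport := h.hasCompactSupport.sub hψ.hasCompactSupport

theorem continuous (h : SmoothCompact φ) : Continuous φ := h.contDiff.continuous

theorem hasLineDerivAt (h : SmoothCompact φ) (i : Fin d) (x : Fin d → ℝ) :
    HasLineDerivAt ℝ φ (Frolov.partialDeriv i φ x) x (Pi.single i 1) :=
  ((h.contDiff.differentiable (by simp)).differentiableAt).lineDifferentiableAt.hasLineDerivAt

theorem integrable (h : SmoothCompact φ) : Integrable φ :=
  h.continuous.integrable_of_hasCompactSupport h.hasCompactSupport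

theorem integrable_sq (h : SmoothCompact φ) : Integrable fun x => φ x ^ 2 := by
  have := (h.mul h.contDiff).integrable
  simpa only [sq] using this

theorem memLp (h : SmoothCompact φ) : MemLp φ 2 :=
  h.continuous.memLp_of_hasCompactSupport h.hasCompactSupport

end SmoothCompact

theorem partialDeriv_comm (h : ContDiff ℝ ∞ φ) (i j : Fin d) :
    partialDeriv i (partialDeriv j φ) = partialDeriv j (partialDeriv i φ) := by
  have hd (x : Fin d → ℝ) : DifferentiableAt ℝ (fderiv ℝ φ) x :=
    ((h.fderiv_right (m := ∞) (by simp)).differentiable (by simp)).differentiableAt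
  have key (a b : Fin d) (x : Fin d → ℝ) : partialDeriv a (partialDeriv b φ) x =
      fderiv ℝ (fderiv ℝ φ) x (Pi.single a 1) (Pi.single b 1) := by
    rw [partialDeriv_eq_fderiv (contDiff_partialDeriv h b), partialDeriv_eq_fderiv h b]
    simp only
    rw [fderiv_clm_apply (hd x) (differentiableAt_const _)]
    simp
  funext x
  rw [key, key]
  exact (h.contDiffAt.isSymmSndFDerivAt (by
    rw [minSmoothness_of_isRCLikeNormedField]
    exact WithTop.coe_le_coe.2 (le_top : (2 : ℕ∞) ≤ ⊤))) _ _

theorem contDiff_partialDeriv_iterate (h : ContDiff ℝ ∞ φ) (i : Fin d) (a : ℕ) :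
    ContDiff ℝ ∞ ((partialDeriv i)^[a] φ) := by
  induction a with
  | zero => exact h
  | succ a ih => rw [Function.iterate_succ_apply']; exact contDiff_partialDeriv ih i

theorem tsupport_partialDeriv_iterate_subset (h : ContDiff ℝ ∞ φ) (i : Fin d) (a : ℕ) :
    tsupport ((partialDeriv i)^[a] φ) ⊆ tsupport φ := by
  induction a with
  | zero => exact subset_rfl
  | succ a ih =>
    rw [Function.iterate_succ_apply']
    exact (tsupport_partialDeriv_subset (contDiff_partialDeriv_iterate h i a) i).trans ih

theorem partialDeriv_iterate_comm (h : ContDiff ℝ ∞ φ) (i j : Fin d) (b : ℕ) :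
    partialDeriv i ((partialDeriv j)^[b] φ) = (partialDeriv j)^[b] (partialDeriv i φ) := by
  induction b with
  | zero => rfl
  | succ b ih =>
    rw [Function.iterate_succ_apply', Function.iterate_succ_apply',
      partialDeriv_comm (contDiff_partialDeriv_iterate h j b), ih]

/-- Mixed derivative with respect to the variables in a list. -/
noncomputable def derivList (α : Fin d → ℕ) (l : List (Fin d)) (φ : (Fin d → ℝ) → ℝ) :
    (Fin d → ℝ) → ℝ :=
  l.foldr (fun i g => (partialDeriv i)^[α i] g) φ

theorem derivList_cons (α : Fin d → ℕ) (i : Fin d) (l : List (Fin d)) :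
    derivList α (i :: l) φ = (partialDeriv i)^[α i] (derivList α l φ) := rfl

theorem contDiff_derivList (h : ContDiff ℝ ∞ φ) (α : Fin d → ℕ) (l : List (Fin d)) :
    ContDiff ℝ ∞ (derivList α l φ) := by
  induction l with
  | nil => exact h
  | cons i l ih => exact contDiff_partialDeriv_iterate ih i _

theorem tsupport_derivList_subset (h : ContDiff ℝ ∞ φ) (α : Fin d → ℕ) (l : List (Fin d)) :
    tsupport (derivList α l φ) ⊆ tsupport φ := by
  induction l with
  | nil => exact subset_rfl
  | cons i l ih =>
    exact (tsupport_partialDeriv_iterate_subset (contDiff_derivList h α l) i _).trans ih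

theorem SmoothCompact.derivList (h : SmoothCompact φ) (α : Fin d → ℕ) (l : List (Fin d)) :
    SmoothCompact (derivList α l φ) where
  contDiff := contDiff_derivList h.contDiff α l
  hasCompactSupport := h.hasCompactSupport.mono'
    ((subset_tsupport _).trans (tsupport_derivList_subset h.contDiff α l))

theorem SmoothCompact.mixedDeriv (h : SmoothCompact φ) (α : Fin d → ℕ) :
    SmoothCompact (mixedDeriv α φ) := h.derivList α _

theorem SmoothCompact.partialDeriv_iterate (h : SmoothCompact φ) (i : Fin d) (a : ℕ) :
    SmoothCompact ((Frolov.partialDeriv i)^[a] φ) where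
  contDiff := contDiff_partialDeriv_iterate h.contDiff i a
  hasCompactSupport := h.hasCompactSupport.mono'
    ((subset_tsupport _).trans (tsupport_partialDeriv_iterate_subset h.contDiff i a))

theorem partialDeriv_derivList (h : ContDiff ℝ ∞ φ) (i : Fin d) (α : Fin d → ℕ)
    (l : List (Fin d)) :
    partialDeriv i (derivList α l φ) = derivList α l (partialDeriv i φ) := by
  induction l with
  | nil => rfl
  | cons j l ih =>
    rw [derivList_cons, derivList_cons, partialDeriv_iterate_comm (contDiff_derivList h α l), ih]

theorem partialDeriv_iterate_derivList (h : ContDiff ℝ ∞ φ) (i : Fin d) (a : ℕ) (α : Fin d → ℕ)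
    (l : List (Fin d)) :
    (partialDeriv i)^[a] (derivList α l φ) = derivList α l ((partialDeriv i)^[a] φ) := by
  induction a with
  | zero => rfl
  | succ a ih =>
    rw [Function.iterate_succ_apply', Function.iterate_succ_apply', ih,
      partialDeriv_derivList (contDiff_partialDeriv_iterate h i a)]

theorem partialDeriv_sub (h : SmoothCompact φ) (hψ : SmoothCompact ψ) (i : Fin d) :
    partialDeriv i (fun x => φ x - ψ x) = fun x => partialDeriv i φ x - partialDeriv i ψ x :=
  funext fun x => HasLineDerivAt.lineDeriv <|
    HasDerivAt.sub (h.hasLineDerivAt i x) (hψ.hasLineDerivAt i x)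

theorem derivList_sub (h : SmoothCompact φ) (hψ : SmoothCompact ψ) (α : Fin d → ℕ)
    (l : List (Fin d)) :
    derivList α l (fun x => φ x - ψ x) = fun x => derivList α l φ x - derivList α l ψ x := by
  induction l with
  | nil => rfl
  | cons i l ih =>
    rw [derivList_cons, ih, derivList_cons, derivList_cons]
    generalize α i = a
    induction a with
    | zero => rfl
    | succ a iha =>
      simp only [Function.iterate_succ_apply']
      rw [iha, partialDeriv_sub ((h.derivList α l).partialDeriv_iterate i a)
        ((hψ.derivList α l).partialDeriv_iterate i a)]

theorem mixedDeriv_sub (h : SmoothCompact φ) (hψ : SmoothCompact ψ) (α : Fin d → ℕ) :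
    mixedDeriv α (fun x => φ x - ψ x) = fun x => mixedDeriv α φ x - mixedDeriv α ψ x :=
  derivList_sub h hψ α _

theorem integral_mul_partialDeriv (h : SmoothCompact φ) (hψ : SmoothCompact ψ) (i : Fin d) :
    ∫ x, φ x * partialDeriv i ψ x = - ∫ x, partialDeriv i φ x * ψ x := by
  rw [partialDeriv_eq_fderiv h.contDiff, partialDeriv_eq_fderiv hψ.contDiff]
  refine integral_mul_fderiv_eq_neg_fderiv_mul_of_integrable ?_ ?_ ?_ ?_ ?_
  · simpa only [partialDeriv_eq_fderiv h.contDiff] using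
      (hψ.mul (h.partialDeriv i).contDiff).integrable
  · simpa only [partialDeriv_eq_fderiv hψ.contDiff] using
      ((hψ.partialDeriv i).mul h.contDiff).integrable
  · exact (hψ.mul h.contDiff).integrable
  · exact fun x _ => (h.contDiff.differentiable (by simp)).differentiableAt
  · exact fun x _ => (hψ.contDiff.differentiable (by simp)).differentiableAt

theorem integral_partialDeriv (h : SmoothCompact φ) (i : Fin d) :
    ∫ x, partialDeriv i φ x = 0 := by
  have hi : Integrable (fun x => fderiv ℝ φ x (Pi.single i 1)) := by
    rw [← partialDeriv_eq_fderiv h.contDiff]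
    exact (h.partialDeriv i).integrable
  have := integral_mul_fderiv_eq_neg_fderiv_mul_of_integrable (μ := volume)
    (f := fun _ : Fin d → ℝ => (1 : ℝ)) (g := φ) (v := Pi.single i 1) (by simp)
    (by simpa using hi) (by simpa using h.integrable) (fun x _ => differentiableAt_const _)
    (fun x _ => (h.contDiff.differentiable (by simp)).differentiableAt)
  rw [partialDeriv_eq_fderiv h.contDiff]
  simpa using this

theorem integral_mul_partialDeriv_iterate (h : SmoothCompact φ) (hψ : SmoothCompact ψ) (i : Fin d)
    (a : ℕ) :
    ∫ x, φ x * (partialDeriv i)^[a] ψ x = (-1) ^ a * ∫ x, (partialDeriv i)^[a] φ x * ψ x := by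
  induction a generalizing φ with
  | zero => simp
  | succ a ih =>
    simp only [Function.iterate_succ_apply' _ a ψ]
    rw [integral_mul_partialDeriv h (hψ.partialDeriv_iterate i a), ih (h.partialDeriv i)]
    simp only [Function.iterate_succ_apply]
    ring

theorem integral_mul_derivList (h : SmoothCompact φ) (hψ : SmoothCompact ψ) (α : Fin d → ℕ)
    (l : List (Fin d)) :
    ∫ x, φ x * derivList α l ψ x =
      (-1) ^ (l.map α).sum * ∫ x, derivList α l φ x * ψ x := by
  induction l generalizing φ with
  | nil => simp [derivList]
  | cons i l ih =>
    rw [derivList_cons, integral_mul_partialDeriv_iterate h (hψ.derivList α l) i,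
      ih (h.partialDeriv_iterate i _), ← partialDeriv_iterate_derivList h.contDiff,
      derivList_cons, List.map_cons, List.sum_cons, pow_add, mul_assoc]

theorem integral_mul_mixedDeriv (h : SmoothCompact φ) (hψ : SmoothCompact ψ) (α : Fin d → ℕ) :
    ∫ x, φ x * mixedDeriv α ψ x = (-1) ^ (∑ i, α i) * ∫ x, mixedDeriv α φ x * ψ x := by
  have := integral_mul_derivList h hψ α (List.finRange d)
  rwa [← List.ofFn_eq_map, List.sum_ofFn] at this

/-- A Poincaré inequality in the `i`-th variable. -/
theorem integral_sq_le_partialDeriv (h : SmoothCompact φ)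
    (hs : tsupport φ ⊆ openCube d) (i : Fin d) :
    ∫ x, φ x ^ 2 ≤ 1 / 2 * ∫ x, partialDeriv i φ x ^ 2 := by
  -- With `s = x i - 1 / 2`, the function `w` satisfies the Riccati inequality `w' - w² ≥ 2` for
  -- `|s| ≤ 1 / 2`. Expanding `(∂φ + wφ)² ≥ 0` and using that `∂(wφ²)` has integral zero gives `∫
  -- (∂φ)² ≥ 2 ∫ φ²`.
  set w : (Fin d → ℝ) → ℝ := fun x => 5 / 2 * (x i - 1 / 2) + 5 * (x i - 1 / 2) ^ 3 with hw
  have hwc : ContDiff ℝ ∞ w := by rw [hw]; fun_prop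
  have hsq : SmoothCompact fun x => φ x * φ x := h.mul h.contDiff
  have hg : SmoothCompact fun x => w x * (φ x * φ x) := hsq.mul hwc
  have hder (x : Fin d → ℝ) : partialDeriv i (fun x => w x * (φ x * φ x)) x =
      (5 / 2 + 15 * (x i - 1 / 2) ^ 2) * φ x ^ 2 + 2 * w x * φ x * partialDeriv i φ x := by
    have h1 := h.hasLineDerivAt i x
    have h2 : HasLineDerivAt ℝ w (5 / 2 + 15 * (x i - 1 / 2) ^ 2) x (Pi.single i 1) := by
      have h3 : HasDerivAt (fun t : ℝ => 5 / 2 * (x i + t - 1 / 2) + 5 * (x i + t - 1 / 2) ^ 3)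
          (5 / 2 + 15 * (x i - 1 / 2) ^ 2) 0 := by
        have h4 : HasDerivAt (fun t : ℝ => x i + t - 1 / 2) 1 0 :=
          ((hasDerivAt_id (0 : ℝ)).const_add (x i)).sub_const (1 / 2)
        convert! (h4.const_mul (5 / 2)).add ((h4.pow 3).const_mul 5) using 1
        simp
        ring
      rw [HasLineDerivAt]
      convert! h3 using 2
      simp [hw]
    have h5 : HasLineDerivAt ℝ (fun x => w x * (φ x * φ x))
        ((5 / 2 + 15 * (x i - 1 / 2) ^ 2) * (φ x * φ x) +
          w x * (partialDeriv i φ x * φ x + φ x * partialDeriv i φ x)) x (Pi.single i 1) := by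
      rw [HasLineDerivAt] at h1 h2 ⊢
      convert! h2.mul (h1.mul h1) using 1
      simp
    rw [partialDeriv, h5.lineDeriv]
    ring
  have hpt (x : Fin d → ℝ) : 2 * φ x ^ 2 ≤
      partialDeriv i φ x ^ 2 + partialDeriv i (fun x => w x * (φ x * φ x)) x := by
    rw [hder]
    by_cases hx : φ x = 0
    · rw [hx]; nlinarith [sq_nonneg (partialDeriv i φ x)]
    · have hx' := (hs (subset_tsupport _ hx)) i (Set.mem_univ i)
      set s : ℝ := x i - 1 / 2 with hsdef
      have hs2 : s ^ 2 ≤ 1 / 4 := by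
        have h1 := hx'.1
        have h2 := hx'.2
        nlinarith
      have hs0 := sq_nonneg s
      have hric : 2 ≤ (5 / 2 + 15 * s ^ 2) - (5 / 2 * s + 5 * s ^ 3) ^ 2 := by
        have : (5 / 2 * s + 5 * s ^ 3) ^ 2 = 25 / 4 * s ^ 2 + 25 * (s ^ 2) ^ 2 + 25 * (s ^ 2) ^ 3 := by
          ring
        rw [this]
        generalize s ^ 2 = u at *
        have h1 : u ^ 2 ≤ 1 / 4 * u := by nlinarith
        have h2 : u ^ 3 ≤ 1 / 16 * u := by nlinarith
        linarith
      have := mul_le_mul_of_nonneg_right hric (sq_nonneg (φ x))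
      have hww : w x = 5 / 2 * s + 5 * s ^ 3 := rfl
      rw [hww]
      nlinarith [sq_nonneg (partialDeriv i φ x + (5 / 2 * s + 5 * s ^ 3) * φ x)]
  have := integral_mono (h.integrable_sq.const_mul 2)
    ((h.partialDeriv i).integrable_sq.add (hg.partialDeriv i).integrable) hpt
  simp only [Pi.add_apply] at this
  rw [integral_add (h.partialDeriv i).integrable_sq (hg.partialDeriv i).integrable,
    integral_partialDeriv hg, integral_const_mul] at this
  linarith

theorem integral_sq_le_partialDeriv_iterate (h : SmoothCompact φ)
    (hs : tsupport φ ⊆ openCube d) (i : Fin d) (a : ℕ) :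
    ∫ x, φ x ^ 2 ≤ (1 / 2) ^ a * ∫ x, (partialDeriv i)^[a] φ x ^ 2 := by
  induction a with
  | zero => simp
  | succ a ih =>
    refine ih.trans ?_
    rw [pow_succ, mul_assoc, Function.iterate_succ_apply']
    exact mul_le_mul_of_nonneg_left (integral_sq_le_partialDeriv (h.partialDeriv_iterate i a)
      ((tsupport_partialDeriv_iterate_subset h.contDiff i a).trans hs) i) (by positivity)

theorem integral_derivList_sq_le (h : SmoothCompact φ) (hs : tsupport φ ⊆ openCube d)
    {α β : Fin d → ℕ} (hαβ : α ≤ β) (l : List (Fin d)) :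
    ∫ x, derivList α l φ x ^ 2 ≤
      (l.map fun i => (1 / 2 : ℝ) ^ (β i - α i)).prod * ∫ x, derivList β l φ x ^ 2 := by
  induction l generalizing φ with
  | nil => simp [derivList]
  | cons i l ih =>
    rw [derivList_cons, partialDeriv_iterate_derivList h.contDiff]
    refine (ih (h.partialDeriv_iterate i _)
      ((tsupport_partialDeriv_iterate_subset h.contDiff i _).trans hs)).trans ?_
    rw [← partialDeriv_iterate_derivList h.contDiff, List.map_cons, List.prod_cons,
      mul_comm ((1 / 2 : ℝ) ^ _), mul_assoc]
    refine mul_le_mul_of_nonneg_left ?_ (List.prod_nonneg fun x hx => ?_)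
    · have h1 := integral_sq_le_partialDeriv_iterate ((h.derivList β l).partialDeriv_iterate i (α i))
        (((tsupport_partialDeriv_iterate_subset (h.derivList β l).contDiff i _).trans
          (tsupport_derivList_subset h.contDiff β l)).trans hs) i (β i - α i)
      rwa [← Function.iterate_add_apply, Nat.sub_add_cancel (hαβ i)] at h1
    · obtain ⟨j, -, rfl⟩ := List.mem_map.1 hx
      positivity

theorem integral_mixedDeriv_sq_le (h : SmoothCompact φ) (hs : tsupport φ ⊆ openCube d)
    {α β : Fin d → ℕ} (hαβ : α ≤ β) :
    ∫ x, mixedDeriv α φ x ^ 2 ≤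
      (∏ i, (1 / 2 : ℝ) ^ (β i - α i)) * ∫ x, mixedDeriv β φ x ^ 2 := by
  have := integral_derivList_sq_le h hs hαβ (List.finRange d)
  rwa [← List.ofFn_eq_map, List.prod_ofFn] at this

/-- Each variable outside `e` lacks `r i` derivatives, at the price `(1 / 2)^(r i)`. The sum over
`e` is the expansion of the product. -/
theorem sum_integral_mixedDeriv_sq_le (h : SmoothCompact φ) (hs : tsupport φ ⊆ openCube d)
    (r : Fin d → ℕ) :
    ∑ e : Finset (Fin d), ∫ x, mixedDeriv (fun i => if i ∈ e then r i else 0) φ x ^ 2 ≤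
      (∏ i, (1 + (1 / 2 : ℝ) ^ r i)) * ∫ x, mixedDeriv r φ x ^ 2 := by
  classical
  have h1 (e : Finset (Fin d)) :
      ∫ x, mixedDeriv (fun i => if i ∈ e then r i else 0) φ x ^ 2 ≤
        (∏ i ∈ Finset.univ \ e, (1 / 2 : ℝ) ^ r i) * ∫ x, mixedDeriv r φ x ^ 2 := by
    refine (integral_mixedDeriv_sq_le h hs (β := r) fun i => ?_).trans (le_of_eq ?_)
    · dsimp only; split_ifs <;> simp
    · congr 1
      rw [← Finset.prod_subset (Finset.sdiff_subset (s := Finset.univ) (t := e))]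
      · refine Finset.prod_congr rfl fun i hi => ?_
        rw [if_neg (Finset.mem_sdiff.1 hi).2, Nat.sub_zero]
      · intro i _ hi
        have : i ∈ e := by simpa using hi
        simp [this]
  refine (Finset.sum_le_sum fun e _ => h1 e).trans (le_of_eq ?_)
  rw [← Finset.sum_mul, Finset.prod_add]
  simp

end Calculus

end Frolov

namespace Frolov

open MeasureTheory Matrix
open scoped ContDiff

/-! ### Fourier transforms of mixed derivatives -/

section Fourier

variable {d : ℕ}

/-- The character `y ↦ exp(-2πi z·y)`. -/
noncomputable def character (z y : Fin d → ℝ) : ℂ :=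
  Complex.exp (-(2 * Real.pi * Complex.I) * ((z ⬝ᵥ y : ℝ) : ℂ))

theorem norm_character (z y : Fin d → ℝ) : ‖character z y‖ = 1 := by
  rw [character, show -(2 * Real.pi * Complex.I) * ((z ⬝ᵥ y : ℝ) : ℂ) =
    ((-(2 * Real.pi * (z ⬝ᵥ y)) : ℝ) : ℂ) * Complex.I by push_cast; ring]
  exact Complex.norm_exp_ofReal_mul_I _

theorem character_add (z y y' : Fin d → ℝ) :
    character z (y + y') = character z y * character z y' := by
  simp only [character, dotProduct_add, Complex.ofReal_add, mul_add, Complex.exp_add]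

theorem character_intCast (k m : Fin d → ℤ) :
    character (fun i => (k i : ℝ)) (fun i => (m i : ℝ)) = 1 := by
  rw [character, show -(2 * Real.pi * Complex.I) *
    ((((fun i => (k i : ℝ)) ⬝ᵥ fun i => (m i : ℝ)) : ℝ) : ℂ) =
    ((-(∑ i, k i * m i) : ℤ) : ℂ) * (2 * Real.pi * Complex.I) by
      simp [dotProduct]; ring]
  exact Complex.exp_int_mul_two_pi_mul_I _

theorem contDiff_dotProduct (z : Fin d → ℝ) : ContDiff ℝ ∞ fun y : Fin d → ℝ => z ⬝ᵥ y := by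
  unfold dotProduct
  fun_prop

theorem continuous_character (z : Fin d → ℝ) : Continuous (character z) := by
  unfold character
  have := (contDiff_dotProduct z).continuous
  fun_prop

theorem hasLineDerivAt_character (z y : Fin d → ℝ) (i : Fin d) :
    HasLineDerivAt ℝ (character z) (-(2 * Real.pi * Complex.I * z i) * character z y) y
      (Pi.single i 1) := by
  rw [HasLineDerivAt]
  have h : (fun t : ℝ => character z (y + t • Pi.single i 1)) = fun t : ℝ =>
      character z y * Complex.exp (-(2 * Real.pi * Complex.I * z i) * (t : ℂ)) := by
    funext t
    rw [character_add]
    congr 1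
    simp only [character, dotProduct_smul, dotProduct_single, smul_eq_mul, mul_one]
    congr 1
    push_cast
    ring
  rw [h]
  have h1 : HasDerivAt (fun t : ℝ => -(2 * Real.pi * Complex.I * z i) * (t : ℂ))
      (-(2 * Real.pi * Complex.I * z i)) 0 := by
    simpa using (Complex.ofRealCLM.hasDerivAt (x := (0 : ℝ))).const_mul
      (-(2 * Real.pi * Complex.I * z i))
  convert! (h1.cexp).const_mul (character z y) using 1
  simp
  ring

/-- The Fourier transform `z ↦ ∫ φ(y) exp(-2πi z·y) dy`. -/
noncomputable def ft (φ : (Fin d → ℝ) → ℝ) (z : Fin d → ℝ) : ℂ :=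
  ∫ y, φ y • character z y

theorem integrable_smul_character {φ : (Fin d → ℝ) → ℝ} (h : Integrable φ) (z : Fin d → ℝ) :
    Integrable fun y => φ y • character z y := by
  refine h.smul_bdd 1 (continuous_character z).aestronglyMeasurable ?_
  exact .of_forall fun y => (norm_character z y).le

variable {φ : (Fin d → ℝ) → ℝ}

theorem ft_partialDeriv (h : SmoothCompact φ) (i : Fin d) (z : Fin d → ℝ) :
    ft (partialDeriv i φ) z = 2 * Real.pi * Complex.I * z i * ft φ z := by
  have hc (y : Fin d → ℝ) : φ y • (-(2 * Real.pi * Complex.I * z i) * character z y) =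
      -(2 * Real.pi * Complex.I * z i) * (φ y • character z y) := by
    simp only [Complex.real_smul]
    ring
  have key := integral_bilinear_hasLineDerivAt_right_eq_neg_left_of_integrable (μ := volume)
    (f := character z) (f' := fun y => -(2 * Real.pi * Complex.I * z i) * character z y)
    (g := φ) (g' := partialDeriv i φ) (v := Pi.single i 1)
    (B := (ContinuousLinearMap.lsmul ℝ ℝ (E := ℂ)).flip) ?_ ?_ ?_ ?_ ?_
  · simp only [ContinuousLinearMap.flip_apply, ContinuousLinearMap.lsmul_apply] at key
    rw [ft, key, ft, funext hc, integral_const_mul, neg_mul, neg_neg]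
  · have := (integrable_smul_character h.integrable z).const_mul (-(2 * Real.pi * Complex.I * z i))
    simpa only [ContinuousLinearMap.flip_apply, ContinuousLinearMap.lsmul_apply, hc] using this
  · simpa using integrable_smul_character (h.partialDeriv i).integrable z
  · simpa using integrable_smul_character h.integrable z
  · exact fun y _ => hasLineDerivAt_character z y i
  · exact fun y _ => h.hasLineDerivAt i y

theorem ft_partialDeriv_iterate (h : SmoothCompact φ) (i : Fin d) (a : ℕ) (z : Fin d → ℝ) :
    ft ((partialDeriv i)^[a] φ) z = (2 * Real.pi * Complex.I * z i) ^ a * ft φ z := by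
  induction a with
  | zero => simp
  | succ a ih =>
    rw [Function.iterate_succ_apply', ft_partialDeriv (h.partialDeriv_iterate i a), ih]
    ring

theorem ft_derivList (h : SmoothCompact φ) (α : Fin d → ℕ) (l : List (Fin d)) (z : Fin d → ℝ) :
    ft (derivList α l φ) z =
      (l.map fun i => (2 * Real.pi * Complex.I * z i) ^ α i).prod * ft φ z := by
  induction l with
  | nil => simp [derivList]
  | cons i l ih =>
    rw [derivList_cons, ft_partialDeriv_iterate (h.derivList α l), ih, List.map_cons,
      List.prod_cons, ← mul_assoc]

theorem ft_mixedDeriv (h : SmoothCompact φ) (α : Fin d → ℕ) (z : Fin d → ℝ) :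
    ft (mixedDeriv α φ) z = (∏ i, (2 * Real.pi * Complex.I * z i) ^ α i) * ft φ z := by
  have := ft_derivList h α (List.finRange d) z
  rwa [← List.ofFn_eq_map, List.prod_ofFn] at this

/-- Reduces the weighted sum in Cauchy–Schwarz to unweighted sums, one for each `e`, to which the
Bessel inequality applies. -/
theorem sum_norm_ft_mixedDeriv_sq (h : SmoothCompact φ) (r : Fin d → ℕ) (z : Fin d → ℝ) :
    ∑ e : Finset (Fin d), ‖ft (mixedDeriv (fun i => if i ∈ e then r i else 0) φ) z‖ ^ 2 =
      (∏ i, (1 + (2 * Real.pi * z i) ^ (2 * r i))) * ‖ft φ z‖ ^ 2 := by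
  classical
  rw [Finset.prod_one_add, Finset.powerset_univ, Finset.sum_mul]
  refine Finset.sum_congr rfl fun e _ => ?_
  rw [ft_mixedDeriv h, norm_mul, mul_pow, norm_prod, ← Finset.prod_pow]
  congr 1
  rw [← Finset.prod_subset (Finset.subset_univ e)]
  · refine Finset.prod_congr rfl fun i hi => ?_
    rw [if_pos hi, norm_pow, ← pow_mul, mul_comm (r i), pow_mul, pow_mul]
    congr 1
    simp [mul_pow]
  · intro i _ hi
    simp [hi]

end Fourier

/-! ### Unfolding integrals over ℝ^d to a fundamental cell -/

section Unfolding

variable {d : ℕ}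

/-- The half-open unit cube `(0,1]^d`, a fundamental domain of `ℤ^d`. -/
def unitCell (d : ℕ) : Set (Fin d → ℝ) := {x | ∀ i, x i ∈ Set.Ioc (0 : ℝ) 1}

theorem measurableSet_unitCell : MeasurableSet (unitCell d) :=
  MeasurableSet.univ_pi' fun _ => measurableSet_Ioc

/-- The embedding of `ℤ^d` into `ℝ^d`. -/
def latticePoint (m : Fin d → ℤ) : Fin d → ℝ := fun i => m i

theorem hasSum_integral_unitCell {E : Type*} [NormedAddCommGroup E] [NormedSpace ℝ E]
    {u : (Fin d → ℝ) → E} (hu : Integrable u) :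
    HasSum (fun m : Fin d → ℤ => ∫ x in unitCell d, u (x + latticePoint m)) (∫ x, u x) := by
  set s : (Fin d → ℤ) → Set (Fin d → ℝ) := fun m => (fun x => x - latticePoint m) ⁻¹' unitCell d
    with hs
  have hmeas (m : Fin d → ℤ) : MeasurableSet (s m) :=
    measurableSet_unitCell.preimage (measurable_id.sub_const _)
  have hdisj : Pairwise (Function.onFun Disjoint s) := by
    intro m m' hne
    rw [Function.onFun, Set.disjoint_left]
    intro x hx hx'
    apply hne
    funext i
    have h1 := hx i
    have h2 := hx' i
    simp only [latticePoint, Pi.sub_apply, Set.mem_Ioc] at h1 h2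
    have h3 : (m i : ℝ) < m' i + 1 := by linarith
    have h4 : (m' i : ℝ) < m i + 1 := by linarith
    have h3' : m i < m' i + 1 := by exact_mod_cast h3
    have h4' : m' i < m i + 1 := by exact_mod_cast h4
    omega
  have hcover : ⋃ m, s m = Set.univ := by
    refine Set.eq_univ_of_forall fun x => Set.mem_iUnion.2 ⟨fun i => ⌈x i⌉ - 1, fun i => ?_⟩
    simp only [latticePoint, Pi.sub_apply, Set.mem_Ioc, Int.cast_sub, Int.cast_one]
    constructor <;> linarith [Int.ceil_lt_add_one (x i), Int.le_ceil (x i)]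
  have h := hasSum_integral_iUnion (μ := volume) hmeas hdisj (f := u) (by
    rw [hcover]; exact hu.integrableOn)
  rw [hcover, setIntegral_univ] at h
  convert! h using 2 with m
  have hpre : (fun x => x + latticePoint m) ⁻¹' (s m) = unitCell d := by
    ext x; simp [hs]
  rw [← hpre]
  exact (measurePreserving_add_right volume (latticePoint m)).setIntegral_preimage_emb
    (measurableEmbedding_addRight _) _ _

theorem integral_eq_integral_unitCell_tsum {E : Type*} [NormedAddCommGroup E] [NormedSpace ℝ E]
    {u : (Fin d → ℝ) → E} (hu : Integrable u) :
    ∫ x, u x = ∫ x in unitCell d, ∑' m : Fin d → ℤ, u (x + latticePoint m) := by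
  have h1 := hasSum_integral_of_summable_integral_norm (μ := volume.restrict (unitCell d))
    (F := fun m x => u (x + latticePoint m))
    (fun m => (hu.comp_add_right _).integrableOn) (hasSum_integral_unitCell hu.norm).summable
  exact (hasSum_integral_unitCell hu).unique h1

theorem integral_comp_mulVec {E : Type*} [NormedAddCommGroup E] [NormedSpace ℝ E]
    {A : Matrix (Fin d) (Fin d) ℝ} (hA : A.det ≠ 0) (u : (Fin d → ℝ) → E) :
    ∫ x, u (A *ᵥ x) = |A.det|⁻¹ • ∫ y, u y := by
  have hemb : MeasurableEmbedding (toLin' A) := by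
    have := (LinearEquiv.ofIsUnitDet (f := toLin' A) (v := Pi.basisFun ℝ (Fin d))
      (v' := Pi.basisFun ℝ (Fin d)) (by
        rw [LinearMap.toMatrix_eq_toMatrix', LinearMap.toMatrix'_toLin']
        exact hA.isUnit)).toContinuousLinearEquiv.toHomeomorph.measurableEmbedding
    exact this
  have h := hemb.integral_map (μ := volume) u
  rw [Real.map_matrix_volume_pi_eq_smul_volume_pi hA, integral_smul_measure] at h
  simp only [toLin'_apply] at h
  rw [← h, abs_inv, ENNReal.toReal_ofReal (by positivity)]

theorem integrable_comp_mulVec {E : Type*} [NormedAddCommGroup E]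
    {A : Matrix (Fin d) (Fin d) ℝ} (hA : A.det ≠ 0) {u : (Fin d → ℝ) → E} (hu : Integrable u) :
    Integrable fun x => u (A *ᵥ x) := by
  have hm : Measurable (toLin' A) := (toLin' A).continuous_of_finiteDimensional.measurable
  have h1 : Integrable u (Measure.map (toLin' A) volume) := by
    rw [Real.map_matrix_volume_pi_eq_smul_volume_pi hA]
    exact hu.smul_measure ENNReal.ofReal_ne_top
  simpa [Function.comp_def] using h1.comp_measurable hm

end Unfolding

end Frolov

namespace Frolov

open MeasureTheory Matrix UnitAddTorus
open scoped ContDiff ComplexConjugate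

/-! ### A Bessel inequality on the dual lattice -/

section Bessel

variable {d : ℕ}

theorem mFourier_neg_eq_character (k : Fin d → ℤ) (x : Fin d → ℝ) :
    mFourier (-k) (fun i => (x i : UnitAddCircle)) = character (latticePoint k) x := by
  simp only [mFourier, ContinuousMap.coe_mk, fourier_coe_apply, character, ← Complex.exp_sum]
  congr 1
  simp only [dotProduct, latticePoint, Pi.neg_apply, Complex.ofReal_sum, Finset.mul_sum]
  refine Finset.sum_congr rfl fun i _ => ?_
  push_cast
  ring

theorem mFourierCoeff_eq_integral_unitCell (f : UnitAddTorus (Fin d) → ℂ) (k : Fin d → ℤ) :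
    mFourierCoeff f k =
      ∫ x in unitCell d, character (latticePoint k) x * f (fun i => (x i : UnitAddCircle)) := by
  rw [mFourierCoeff_eq_integral f k 0]
  simp only [mFourier_neg_eq_character, smul_eq_mul, Pi.zero_apply, zero_add]
  rfl

theorem mFourierCoeff_mFourier (k l : Fin d → ℤ) :
    mFourierCoeff (mFourier l) k = if k = l then 1 else 0 := by
  rw [← mFourierCoeff_toLp, ← mFourierBasis_repr, mFourierBasis.repr_apply_apply,
    coe_mFourierBasis]
  exact orthonormal_iff_ite.1 orthonormal_mFourier k l

theorem integral_unitCell_character (k : Fin d → ℤ) :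
    ∫ x in unitCell d, character (latticePoint k) x = if k = 0 then 1 else 0 := by
  have := mFourierCoeff_eq_integral_unitCell (mFourier (0 : Fin d → ℤ)) k
  rw [mFourierCoeff_mFourier, mFourier_zero] at this
  simpa using this.symm

theorem character_mul_conj (k l : Fin d → ℤ) (x : Fin d → ℝ) :
    character (latticePoint k) x * conj (character (latticePoint l) x) =
      character (latticePoint (k - l)) x := by
  simp only [character, ← Complex.exp_conj, ← Complex.exp_add]
  congr 1
  have : latticePoint (k - l) = latticePoint k - latticePoint l := by
    funext i; simp [latticePoint]
  have h2 : conj (2 : ℂ) = 2 := Complex.conj_ofNat 2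
  rw [this, sub_dotProduct]
  simp [h2]
  ring

theorem volume_unitCell : volume (unitCell d) = 1 := by
  have : unitCell d = Set.univ.pi fun _ => Set.Ioc 0 1 := by ext; simp [unitCell]
  rw [this, Real.volume_pi_Ioc]
  simp

instance : IsFiniteMeasure (volume.restrict (unitCell d)) :=
  ⟨by simp [volume_unitCell]⟩

theorem integral_unitCell_norm_sq (F : Finset (Fin d → ℤ)) (a : (Fin d → ℤ) → ℂ) :
    ∫ x in unitCell d, ‖∑ k ∈ F, a k * character (latticePoint k) x‖ ^ 2 = ∑ k ∈ F, ‖a k‖ ^ 2 := by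
  have hint (c : ℂ) (k : Fin d → ℤ) :
      Integrable (fun x => c * character (latticePoint k) x) (volume.restrict (unitCell d)) := by
    refine (Integrable.of_bound (C := 1) (continuous_character _).aestronglyMeasurable
      (.of_forall fun x => (norm_character _ x).le)).const_mul c
  have h1 (x : Fin d → ℝ) : ((‖∑ k ∈ F, a k * character (latticePoint k) x‖ ^ 2 : ℝ) : ℂ) =
      ∑ k ∈ F, ∑ l ∈ F, (a k * conj (a l)) * character (latticePoint (k - l)) x := by
    rw [Complex.ofReal_pow, ← Complex.mul_conj', map_sum, Finset.sum_mul_sum]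
    refine Finset.sum_congr rfl fun k _ => Finset.sum_congr rfl fun l _ => ?_
    rw [map_mul, ← character_mul_conj]
    ring
  have h2 : ((∫ x in unitCell d, ‖∑ k ∈ F, a k * character (latticePoint k) x‖ ^ 2 : ℝ) : ℂ) =
      ((∑ k ∈ F, ‖a k‖ ^ 2 : ℝ) : ℂ) := by
    rw [← integral_complex_ofReal]
    simp only [h1]
    rw [integral_finsetSum _ fun k _ => integrable_finsetSum _ fun l _ => hint _ _]
    rw [Complex.ofReal_sum]
    refine Finset.sum_congr rfl fun k hk => ?_
    rw [integral_finsetSum _ fun l _ => hint _ _]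
    simp only [integral_const_mul, integral_unitCell_character, sub_eq_zero]
    simp [hk, Complex.mul_conj']
  exact_mod_cast h2

theorem character_mulVec (A : Matrix (Fin d) (Fin d) ℝ) (z x : Fin d → ℝ) :
    character z (A *ᵥ x) = character (Aᵀ *ᵥ z) x := by
  rw [character, character, dotProduct_mulVec, mulVec_transpose]

theorem character_add_latticePoint (k m : Fin d → ℤ) (x : Fin d → ℝ) :
    character (latticePoint k) (x + latticePoint m) = character (latticePoint k) x := by
  rw [character_add]
  exact (congrArg _ (character_intCast k m)).trans (mul_one _)

theorem isBounded_openCube : Bornology.IsBounded (openCube d : Set (Fin d → ℝ)) :=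
  (Metric.isBounded_Icc (0 : Fin d → ℝ) 1).subset fun _ hx =>
    ⟨fun i => (hx i (Set.mem_univ i)).1.le, fun i => (hx i (Set.mem_univ i)).2.le⟩

/-- A Bessel inequality for functions supported in the unit cube, sampled on the dual of the
lattice `A ℤ^d`, when translates of this lattice have at most `M` points in the cube. -/
theorem sum_norm_ft_sq_le {A : Matrix (Fin d) (Fin d) ℝ} (hA : A.det ≠ 0) {M : ℝ} (hM0 : 0 < M)
    (hM : ∀ (x : Fin d → ℝ) (F : Finset (Fin d → ℤ)),
      (∀ m ∈ F, A *ᵥ (x + latticePoint m) ∈ openCube d) → (F.card : ℝ) ≤ M)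
    {z : (Fin d → ℤ) → Fin d → ℝ} (hz : ∀ k, Aᵀ *ᵥ z k = latticePoint k)
    {φ : (Fin d → ℝ) → ℝ} (hφ : Integrable φ) (hφ2 : Integrable fun x => φ x ^ 2)
    (hsupp : ∀ x ∉ openCube d, φ x = 0) (F : Finset (Fin d → ℤ)) :
    ∑ k ∈ F, ‖ft φ (z k)‖ ^ 2 ≤ |A.det| * M * ∫ x, φ x ^ 2 := by
  set c : (Fin d → ℤ) → ℂ := fun k => ft φ (z k) with hc
  set X := ∑ k ∈ F, ‖c k‖ ^ 2 with hX
  -- Duality: testing `φ` against the exponential sum with coefficients `conj (c k)` reproduces `X`,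
  -- so it suffices to control `h` in `L₂` of the cube.
  set h : (Fin d → ℝ) → ℂ := fun y => ∑ k ∈ F, conj (c k) * character (z k) y with hh
  have hhc : Continuous h :=
    continuous_finsetSum _ fun k _ => continuous_const.mul (continuous_character _)
  set K := |A.det| * M with hK
  have hKpos : 0 < K := mul_pos (abs_pos.2 hA) hM0
  have hXint : (X : ℂ) = ∫ y, φ y • h y := by
    simp only [hh, Finset.smul_sum]
    have hr (k : Fin d → ℤ) : (fun y => φ y • (conj (c k) * character (z k) y)) =
        fun y => conj (c k) * (φ y • character (z k) y) := by
      funext y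
      simp only [Complex.real_smul]
      ring
    rw [integral_finsetSum]
    · simp only [hr, integral_const_mul]
      rw [hX, Complex.ofReal_sum]
      refine Finset.sum_congr rfl fun k _ => ?_
      rw [Complex.ofReal_pow, ← Complex.conj_mul']
      rfl
    · intro k _
      rw [hr]
      exact (integrable_smul_character hφ _).const_mul _
  set u : (Fin d → ℝ) → ℝ := (openCube d : Set (Fin d → ℝ)).indicator fun y => ‖h y‖ ^ 2 with hu
  have hunn (y : Fin d → ℝ) : 0 ≤ u y := Set.indicator_nonneg (fun _ _ => by positivity) y
  have hui : Integrable u := by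
    rw [hu, integrable_indicator_iff (openCube d).isOpen.measurableSet]
    exact ((hhc.norm.pow 2).continuousOn.integrableOn_compact
      isBounded_openCube.isCompact_closure).mono_set subset_closure
  have hhA (x : Fin d → ℝ) :
      h (A *ᵥ x) = ∑ k ∈ F, conj (c k) * character (latticePoint k) x := by
    simp only [hh, character_mulVec, hz]
  -- `h ∘ A` is a ℤ^d-periodic trigonometric polynomial. Unfolding the cube covers each point of the
  -- cell at most `M` times, and orthonormality of the characters yields `X`.
  have huX : ∫ y, u y ≤ K * X := by
    have h1 := integral_comp_mulVec hA u
    rw [integral_eq_integral_unitCell_tsum (integrable_comp_mulVec hA hui), smul_eq_mul,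
      eq_inv_mul_iff_mul_eq₀ (abs_pos.2 hA).ne'] at h1
    rw [← h1, hK, mul_assoc]
    refine mul_le_mul_of_nonneg_left ?_ (abs_nonneg _)
    have h2 : ∫ x in unitCell d, M * ‖h (A *ᵥ x)‖ ^ 2 = M * X := by
      rw [integral_const_mul]
      simp only [hhA]
      rw [integral_unitCell_norm_sq F fun k => conj (c k)]
      simp [hX]
    rw [← h2]
    refine integral_mono_of_nonneg (.of_forall fun x => tsum_nonneg fun m => hunn _) ?_
      (.of_forall fun x => ?_)
    · refine Integrable.const_mul (Integrable.of_bound (C := (∑ k ∈ F, ‖c k‖) ^ 2) ?_ ?_) M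
      · exact ((hhc.comp (A.mulVecLin.continuous_of_finiteDimensional)).norm.pow
          2).aestronglyMeasurable
      · refine .of_forall fun x => ?_
        rw [hhA, norm_pow, norm_norm]
        refine pow_le_pow_left₀ (norm_nonneg _) ((norm_sum_le _ _).trans (le_of_eq ?_)) 2
        simp [norm_character]
    · refine Real.tsum_le_of_sum_le (fun m => hunn _) fun G => ?_
      classical
      have hper (m : Fin d → ℤ) : h (A *ᵥ (x + latticePoint m)) = h (A *ᵥ x) := by
        rw [hhA, hhA]
        simp only [character_add_latticePoint]
      have h3 : ∑ m ∈ G, u (A *ᵥ (x + latticePoint m)) =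
          ((G.filter fun m => A *ᵥ (x + latticePoint m) ∈ openCube d).card : ℝ) *
            ‖h (A *ᵥ x)‖ ^ 2 := by
        rw [← nsmul_eq_mul, ← Finset.sum_const, Finset.sum_filter]
        refine Finset.sum_congr rfl fun m _ => ?_
        simp only [hu, Set.indicator_apply, hper, SetLike.mem_coe]
      rw [h3]
      exact mul_le_mul_of_nonneg_right (hM x _ fun m hm => (Finset.mem_filter.1 hm).2)
        (by positivity)
  -- Young's inequality, with the weight `K` chosen so that the second term integrates to at most `X
  -- / 2` and can be absorbed.
  have hpt (y : Fin d → ℝ) : ‖φ y • h y‖ ≤ K / 2 * φ y ^ 2 + (2 * K)⁻¹ * u y := by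
    by_cases hy : y ∈ openCube d
    · have : u y = ‖h y‖ ^ 2 := Set.indicator_of_mem hy _
      rw [this, norm_smul, Real.norm_eq_abs, ← sq_abs (φ y)]
      have h4 : K / 2 * |φ y| ^ 2 + (2 * K)⁻¹ * ‖h y‖ ^ 2 - |φ y| * ‖h y‖ =
          (2 * K)⁻¹ * (K * |φ y| - ‖h y‖) ^ 2 := by
        field_simp
        ring
      have : 0 ≤ (2 * K)⁻¹ * (K * |φ y| - ‖h y‖) ^ 2 := by positivity
      linarith
    · rw [hsupp y hy]
      have := hunn y
      simp only [zero_smul, norm_zero]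
      positivity
  have hi1 : Integrable fun y => K / 2 * φ y ^ 2 := hφ2.const_mul _
  have hi2 : Integrable fun y => (2 * K)⁻¹ * u y := hui.const_mul _
  have hX0 : 0 ≤ X := Finset.sum_nonneg fun _ _ => by positivity
  have hX1 : X ≤ ∫ y, (K / 2 * φ y ^ 2 + (2 * K)⁻¹ * u y) := by
    calc X = ‖(X : ℂ)‖ := by rw [Complex.norm_real, Real.norm_of_nonneg hX0]
      _ ≤ ∫ y, ‖φ y • h y‖ := hXint ▸ norm_integral_le_integral_norm _
      _ ≤ _ := integral_mono_of_nonneg (.of_forall fun _ => norm_nonneg _) (hi1.add hi2)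
        (.of_forall hpt)
  rw [integral_add hi1 hi2, integral_const_mul, integral_const_mul] at hX1
  have hX2 : (2 * K)⁻¹ * ∫ y, u y ≤ X / 2 := by
    refine (mul_le_mul_of_nonneg_left huX (by positivity)).trans (le_of_eq ?_)
    field_simp
  linarith

end Bessel

/-! ### Poisson summation for continuous functions of compact support -/

section Poisson

variable {d : ℕ}

theorem isOpenQuotientMap_coe_unitAddTorus :
    IsOpenQuotientMap fun (x : Fin d → ℝ) (i : Fin d) => (x i : UnitAddCircle) :=
  IsOpenQuotientMap.piMap (f := fun (_ : Fin d) (t : ℝ) => (t : UnitAddCircle))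
    fun _ => QuotientAddGroup.isOpenQuotientMap_mk

theorem locallyFinite_support_translates {G : (Fin d → ℝ) → ℂ} (hs : HasCompactSupport G) :
    LocallyFinite fun m : Fin d → ℤ => Function.support fun x => G (x + latticePoint m) := by
  obtain ⟨R, hR⟩ := hs.isCompact.isBounded.exists_norm_le
  intro x
  refine ⟨Metric.ball x 1, Metric.ball_mem_nhds x one_pos, ?_⟩
  refine ((isCompact_closedBall (0 : Fin d → ℤ) (R + (‖x‖ + 1))).finite_of_discrete).subset ?_
  rintro m ⟨y, hy, hyx⟩
  have h1 : ‖y + latticePoint m‖ ≤ R := hR _ (subset_tsupport _ hy)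
  have h2 : ‖y‖ ≤ ‖x‖ + 1 := by
    have := norm_le_norm_add_norm_sub' y x
    rw [Metric.mem_ball, dist_eq_norm] at hyx
    linarith
  have h3 : ‖latticePoint m‖ = ‖m‖ := by
    simp [latticePoint, nnnorm, norm]
  have h4 := norm_le_add_norm_add (latticePoint m) y
  rw [mem_closedBall_zero_iff, ← h3]
  rw [add_comm (latticePoint m)] at h4
  linarith

/-- Near any point only finitely many translates are nonzero, so the sum is continuous; being
periodic, it descends to the torus. -/
theorem exists_periodization {G : (Fin d → ℝ) → ℂ} (hc : Continuous G) (hs : HasCompactSupport G) :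
    ∃ p : C(UnitAddTorus (Fin d), ℂ), ∀ x : Fin d → ℝ,
      p (fun i => (x i : UnitAddCircle)) = ∑' m, G (x + latticePoint m) := by
  have hlf := locallyFinite_support_translates hs
  have hcont : Continuous fun x : Fin d → ℝ => ∑' m, G (x + latticePoint m) := by
    have h1 := continuous_finsum (f := fun (m : Fin d → ℤ) x => G (x + latticePoint m))
      (fun m => hc.comp (continuous_id.add continuous_const)) hlf
    convert! h1 using 2 with x
    exact tsum_eq_finsum ((hlf.point_finite x).subset fun m hm => hm)
  let π : C(Fin d → ℝ, UnitAddTorus (Fin d)) :=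
    ⟨fun x i => (x i : UnitAddCircle), isOpenQuotientMap_coe_unitAddTorus.continuous⟩
  have hq : Topology.IsQuotientMap π := isOpenQuotientMap_coe_unitAddTorus.isQuotientMap
  let g : C(Fin d → ℝ, ℂ) := ⟨_, hcont⟩
  have hfac : Function.FactorsThrough g π := by
    intro x y hxy
    have h1 (i : Fin d) : ∃ k : ℤ, y i = x i + k := by
      have := congrFun hxy i
      have h2 := (QuotientAddGroup.eq.1 this)
      obtain ⟨k, hk⟩ := AddSubgroup.mem_zmultiples_iff.1 h2
      exact ⟨k, by simp at hk; linarith⟩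
    choose k hk using h1
    have hy : y = x + latticePoint k := funext hk
    simp only [g, ContinuousMap.coe_mk]
    rw [hy, ← (Equiv.addLeft k).tsum_eq]
    refine tsum_congr fun m => ?_
    congr 1
    funext i
    simp [latticePoint]
    ring
  exact ⟨hq.lift g hfac, fun x => congrFun (congrArg DFunLike.coe (hq.lift_comp g hfac)) x⟩

/-- Poisson summation over the lattice `A ℤ^d`. -/
theorem tsum_eq_tsum_ft {A : Matrix (Fin d) (Fin d) ℝ} (hA : A.det ≠ 0)
    {z : (Fin d → ℤ) → Fin d → ℝ} (hz : ∀ k, Aᵀ *ᵥ z k = latticePoint k)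
    {f : (Fin d → ℝ) → ℝ} (hf : Continuous f) (hs : HasCompactSupport f)
    (hsum : Summable fun k => ft f (z k)) :
    ((|A.det| : ℝ) : ℂ) * ∑' m : Fin d → ℤ, (f (A *ᵥ latticePoint m) : ℂ) = ∑' k, ft f (z k) := by
  have hAc : Continuous fun x : Fin d → ℝ => A *ᵥ x :=
    A.mulVecLin.continuous_of_finiteDimensional
  set G : (Fin d → ℝ) → ℂ := fun x => f (A *ᵥ x) with hG
  have hGc : Continuous G := Complex.continuous_ofReal.comp (hf.comp hAc)
  have hGs : HasCompactSupport G := by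
    have h1 : IsCompact ((fun y => A⁻¹ *ᵥ y) '' tsupport f) :=
      hs.isCompact.image (A⁻¹).mulVecLin.continuous_of_finiteDimensional
    refine HasCompactSupport.intro h1 fun x hx => ?_
    by_contra hne
    refine hx ⟨A *ᵥ x, subset_tsupport _ fun h0 => hne (by simp [hG, h0]), ?_⟩
    simp [mulVec_mulVec, nonsing_inv_mul _ hA.isUnit]
  obtain ⟨p, hp⟩ := exists_periodization hGc hGs
  -- Unfolding identifies the Fourier coefficients of the periodisation of `f ∘ A`. Their
  -- summability makes the Fourier series converge pointwise, and the claim is its value at `0`.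
  have hcoeff (k : Fin d → ℤ) : mFourierCoeff p k = ((|A.det| : ℝ) : ℂ)⁻¹ * ft f (z k) := by
    have hi : Integrable fun y => f y • character (z k) y :=
      integrable_smul_character (hf.integrable_of_hasCompactSupport hs) _
    have h1 := integral_comp_mulVec hA fun y => f y • character (z k) y
    rw [integral_eq_integral_unitCell_tsum (integrable_comp_mulVec hA hi)] at h1
    rw [mFourierCoeff_eq_integral_unitCell, ft]
    rw [Complex.real_smul, Complex.ofReal_inv] at h1
    rw [← h1]
    refine integral_congr_ae (.of_forall fun x => ?_)
    simp only [hp, character_mulVec, hz, character_add_latticePoint, Complex.real_smul]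
    rw [← tsum_mul_left]
    exact tsum_congr fun m => mul_comm _ _
  have hsum' : Summable (mFourierCoeff p) := by
    rw [funext hcoeff]; exact hsum.mul_left _
  have h0 := (hasSum_mFourier_series_apply_of_summable hsum' 0).tsum_eq
  have hp0 : p 0 = ∑' m, (f (A *ᵥ latticePoint m) : ℂ) := by
    have := hp 0
    simp only [zero_add] at this
    exact this
  have hone (k : Fin d → ℤ) : mFourier k (0 : UnitAddTorus (Fin d)) = 1 := by
    simp [mFourier]
  simp only [hone, hcoeff, smul_eq_mul, mul_one] at h0
  rw [tsum_mul_left, hp0] at h0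
  rw [← h0, mul_inv_cancel_left₀]
  exact_mod_cast (abs_pos.2 hA).ne'

end Poisson

end Frolov

namespace Frolov

open MeasureTheory Filter
open scoped ContDiff Topology ENNReal

/-! ### Limits in `L₂` -/

section SquareIntegrable

variable {α : Type*} [MeasurableSpace α] {μ : Measure α}

theorem inner_toLp_eq_integral {u v : α → ℝ} (hu : MemLp u 2 μ) (hv : MemLp v 2 μ) :
    inner ℝ (hu.toLp u) (hv.toLp v) = ∫ x, u x * v x ∂μ := by
  rw [L2.inner_def]
  refine integral_congr_ae ?_
  filter_upwards [hu.coeFn_toLp, hv.coeFn_toLp] with x h1 h2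
  rw [h1, h2]
  simp [mul_comm]

theorem norm_toLp_sq_eq_integral {u : α → ℝ} (hu : MemLp u 2 μ) :
    ‖hu.toLp u‖ ^ 2 = ∫ x, u x ^ 2 ∂μ := by
  rw [← real_inner_self_eq_norm_sq, inner_toLp_eq_integral hu hu]
  simp only [sq]

variable {u : ℕ → α → ℝ} (hu : ∀ k, MemLp (u k) 2 μ) {g : α → ℝ} (hg : MemLp g 2 μ)

theorem tendsto_integral_mul_of_tendsto_toLp
    (h : Tendsto (fun k => (hu k).toLp (u k)) atTop (𝓝 (hg.toLp g))) {v : α → ℝ}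
    (hv : MemLp v 2 μ) :
    Tendsto (fun k => ∫ x, u k x * v x ∂μ) atTop (𝓝 (∫ x, g x * v x ∂μ)) := by
  have := h.inner (tendsto_const_nhds (x := hv.toLp v)) (𝕜 := ℝ)
  simpa only [inner_toLp_eq_integral] using this

theorem tendsto_integral_sq_of_tendsto_toLp
    (h : Tendsto (fun k => (hu k).toLp (u k)) atTop (𝓝 (hg.toLp g))) :
    Tendsto (fun k => ∫ x, u k x ^ 2 ∂μ) atTop (𝓝 (∫ x, g x ^ 2 ∂μ)) := by
  have := (h.norm).pow 2
  simpa only [norm_toLp_sq_eq_integral] using this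

/-- The limit is tested against its own restriction to the complement of `S`. -/
theorem ae_eq_zero_of_tendsto_toLp
    (h : Tendsto (fun k => (hu k).toLp (u k)) atTop (𝓝 (hg.toLp g))) {S : Set α}
    (hS : MeasurableSet S) (h0 : ∀ k, ∀ x ∉ S, u k x = 0) :
    ∀ᵐ x ∂μ, x ∉ S → g x = 0 := by
  have hv : MemLp (Sᶜ.indicator g) 2 μ := hg.indicator hS.compl
  have h1 := tendsto_integral_mul_of_tendsto_toLp hu hg h hv
  have h2 (k : ℕ) : ∫ x, u k x * Sᶜ.indicator g x ∂μ = 0 := by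
    refine integral_eq_zero_of_ae (.of_forall fun x => ?_)
    by_cases hx : x ∈ S
    · simp [hx]
    · simp [h0 k x hx]
  simp only [h2] at h1
  have h3 := tendsto_nhds_unique h1 tendsto_const_nhds
  have h4 (x : α) : g x * Sᶜ.indicator g x = Sᶜ.indicator g x ^ 2 := by
    by_cases hx : x ∈ S <;> simp [hx, sq]
  simp only [h4] at h3
  rw [integral_eq_zero_iff_of_nonneg (fun x => sq_nonneg _) hv.integrable_sq] at h3
  filter_upwards [h3] with x hx hxS
  have : Sᶜ.indicator g x ^ 2 = 0 := hx
  simpa [hxS] using this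

end SquareIntegrable

/-! ### Passing from test functions to the completion -/

section Space

variable {d : ℕ}

theorem openCube_subset_Icc : (openCube d : Set (Fin d → ℝ)) ⊆ Set.Icc 0 1 := fun _ hx =>
  ⟨fun i => (hx i (Set.mem_univ i)).1.le, fun i => (hx i (Set.mem_univ i)).2.le⟩

theorem volume_Icc_zero_one : volume (Set.Icc (0 : Fin d → ℝ) 1) = 1 := by
  rw [Real.volume_Icc_pi]; simp

theorem TestFunction.smoothCompact {Ω : TopologicalSpace.Opens (Fin d → ℝ)}
    (φ : TestFunction Ω ℝ ⊤) : SmoothCompact φ :=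
  ⟨φ.contDiff, φ.hasCompactSupport⟩

/-- A sequence of test functions which converges to `f` in the space `H^r_mix`. -/
structure Approximation (r : Fin d → ℕ) (f g : (Fin d → ℝ) → ℝ)
    (φ : ℕ → (Fin d → ℝ) → ℝ) : Prop where
  smoothCompact : ∀ k, SmoothCompact (φ k)
  tsupport_subset : ∀ k, tsupport (φ k) ⊆ openCube d
  memLp : MemLp f 2
  memLp_deriv : MemLp g 2
  tendsto : Tendsto (fun k => (smoothCompact k).memLp.toLp (φ k)) atTop (𝓝 (memLp.toLp f))
  tendsto_deriv : Tendsto (fun k => ((smoothCompact k).mixedDeriv r).memLp.toLp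
    (mixedDeriv r (φ k))) atTop (𝓝 (memLp_deriv.toLp g))

theorem integral_mixedDeriv_sq_le_hmixNorm (r : Fin d → ℕ) (φ : (Fin d → ℝ) → ℝ) :
    ∫ x, mixedDeriv r φ x ^ 2 ≤ hmixNorm r φ ^ 2 := by
  rw [hmixNorm, Real.sq_sqrt (Finset.sum_nonneg fun e _ => integral_nonneg fun x => sq_nonneg _)]
  have := Finset.single_le_sum (f := fun e : Finset (Fin d) =>
    ∫ x, mixedDeriv (fun i => if i ∈ e then r i else 0) φ x ^ 2)
    (fun e _ => integral_nonneg fun x => sq_nonneg _) (Finset.mem_univ Finset.univ)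
  simpa using this

/-- The top derivative is the summand `e = univ` of the norm, so it is Cauchy in `L₂` and converges
by completeness. -/
theorem MemHmix.exists_approximation {r : Fin d → ℕ} {f : (Fin d → ℝ) → ℝ} (hf : MemHmix r f) :
    ∃ g φ, Approximation r f g φ := by
  obtain ⟨φ, hcauchy, hlim⟩ := hf.exists_approx
  have hφ (k : ℕ) : SmoothCompact (φ k) := TestFunction.smoothCompact (φ k)
  have hfm : MemLp f 2 := by
    obtain ⟨k, hk⟩ := (hlim.eventually (gt_mem_nhds ENNReal.zero_lt_top)).exists
    have h1 : MemLp (fun x => φ k x - f x) 2 :=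
      ⟨((hφ k).continuous.sub hf.continuous).aestronglyMeasurable, hk⟩
    have h2 := (hφ k).memLp.sub h1
    have h3 : (⇑(φ k) - fun x => φ k x - f x) = f := by funext x; simp
    rwa [h3] at h2
  set G : ℕ → Lp ℝ 2 (volume : Measure (Fin d → ℝ)) :=
    fun k => ((hφ k).mixedDeriv r).memLp.toLp (mixedDeriv r (φ k)) with hG
  have hGc : CauchySeq G := by
    refine Metric.cauchySeq_iff.2 fun ε hε => ?_
    obtain ⟨N, hN⟩ := hcauchy ε hε
    refine ⟨N, fun k hk l hl => ?_⟩
    rw [dist_eq_norm, hG, ← MemLp.toLp_sub]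
    have h1 : ‖(((hφ k).mixedDeriv r).memLp.sub ((hφ l).mixedDeriv r).memLp).toLp _‖ ^ 2 ≤
        hmixNorm r (fun x => φ k x - φ l x) ^ 2 := by
      rw [norm_toLp_sq_eq_integral]
      refine le_trans (le_of_eq ?_) (integral_mixedDeriv_sq_le_hmixNorm r _)
      rw [mixedDeriv_sub (hφ k) (hφ l)]
      rfl
    exact (abs_le_of_sq_le_sq' h1 (Real.sqrt_nonneg _)).2.trans_lt (hN k hk l hl)
  obtain ⟨g, hg⟩ := cauchySeq_tendsto_of_complete hGc
  refine ⟨g, fun k => φ k, ⟨hφ, fun k => (φ k).tsupport_subset, hfm, Lp.memLp g, ?_, ?_⟩⟩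
  · exact (Lp.tendsto_Lp_iff_tendsto_eLpNorm'' _ (fun k => (hφ k).memLp) f hfm).2 hlim
  · rw [Lp.toLp_coeFn]
    exact hg

namespace Approximation

variable {r : Fin d → ℕ} {f g : (Fin d → ℝ) → ℝ} {φ : ℕ → (Fin d → ℝ) → ℝ}

theorem hasWeakDeriv (h : Approximation r f g φ) : HasWeakDeriv r f g := by
  refine ⟨h.memLp_deriv.locallyIntegrable (by norm_num), fun ψ => ?_⟩
  have hψ : SmoothCompact ψ := TestFunction.smoothCompact ψ
  have h1 := tendsto_integral_mul_of_tendsto_toLp _ h.memLp h.tendsto (hψ.mixedDeriv r).memLp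
  have h2 := (tendsto_integral_mul_of_tendsto_toLp _ h.memLp_deriv h.tendsto_deriv
    hψ.memLp).const_mul ((-1) ^ (∑ i, r i))
  simp only [← integral_mul_mixedDeriv (h.smoothCompact _) hψ] at h2
  exact tendsto_nhds_unique h1 h2

/-- `weakDeriv` is an arbitrary choice; uniqueness of weak derivatives identifies it with the `L₂`
limit. -/
theorem weakDeriv_ae_eq (h : Approximation r f g φ) : weakDeriv r f =ᵐ[volume] g := by
  have hex : ∃ g, HasWeakDeriv r f g := ⟨g, h.hasWeakDeriv⟩
  have h1 : HasWeakDeriv r f (weakDeriv r f) := by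
    rw [weakDeriv, dif_pos hex]
    exact hex.choose_spec
  refine ae_eq_of_integral_contDiff_smul_eq h1.1 h.hasWeakDeriv.1 fun ψ hψ hψc => ?_
  have e1 := h1.2 ⟨ψ, hψ, hψc, fun _ _ => trivial⟩
  have e2 := h.hasWeakDeriv.2 ⟨ψ, hψ, hψc, fun _ _ => trivial⟩
  rw [e1] at e2
  have e3 := mul_left_cancel₀ (pow_ne_zero _ (by norm_num)) e2
  simp only [smul_eq_mul, mul_comm (ψ _)]
  exact e3

theorem eq_zero_of_notMem (h : Approximation r f g φ) (k : ℕ) {x : Fin d → ℝ}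
    (hx : x ∉ openCube d) : φ k x = 0 :=
  image_eq_zero_of_notMem_tsupport fun hx' => hx (h.tsupport_subset k hx')

theorem mixedDeriv_eq_zero_of_notMem (h : Approximation r f g φ) (k : ℕ) (α : Fin d → ℕ)
    {x : Fin d → ℝ} (hx : x ∉ openCube d) : mixedDeriv α (φ k) x = 0 :=
  image_eq_zero_of_notMem_tsupport fun hx' => hx (h.tsupport_subset k
    (tsupport_derivList_subset (h.smoothCompact k).contDiff α _ hx'))

theorem tendsto_integral_sq (h : Approximation r f g φ) :
    Tendsto (fun k => ∫ x, mixedDeriv r (φ k) x ^ 2) atTop (𝓝 (spaceNorm r f ^ 2)) := by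
  have h1 := tendsto_integral_sq_of_tendsto_toLp _ h.memLp_deriv h.tendsto_deriv
  have h2 := ae_eq_zero_of_tendsto_toLp _ h.memLp_deriv h.tendsto_deriv
    (measurableSet_Icc (a := (0 : Fin d → ℝ)) (b := 1)) fun k x hx =>
      h.mixedDeriv_eq_zero_of_notMem k r fun hx' => hx (openCube_subset_Icc hx')
  have h3 : spaceNorm r f ^ 2 = ∫ x, g x ^ 2 := by
    rw [spaceNorm, Real.sq_sqrt (integral_nonneg fun x => sq_nonneg _),
      setIntegral_congr_ae (g := fun x => g x ^ 2) measurableSet_Icc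
        (h.weakDeriv_ae_eq.mono fun x hx _ => by rw [hx])]
    refine setIntegral_eq_integral_of_ae_compl_eq_zero ?_
    filter_upwards [h2] with x hx hxS
    simp [hx hxS]
  rwa [h3]

theorem eq_zero_of_notMem_Icc (h : Approximation r f g φ) (hf : Continuous f) {x : Fin d → ℝ}
    (hx : x ∉ Set.Icc (0 : Fin d → ℝ) 1) : f x = 0 := by
  have h2 := ae_eq_zero_of_tendsto_toLp _ h.memLp h.tendsto
    (measurableSet_Icc (a := (0 : Fin d → ℝ)) (b := 1)) fun k x hx =>
      h.eq_zero_of_notMem k fun hx' => hx (openCube_subset_Icc hx')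
  have h3 : f =ᵐ[volume.restrict (Set.Icc (0 : Fin d → ℝ) 1)ᶜ] fun _ => 0 :=
    (ae_restrict_iff' measurableSet_Icc.compl).2 h2
  exact Measure.eqOn_open_of_ae_eq h3 isClosed_Icc.isOpen_compl hf.continuousOn
    continuousOn_const hx

/-- All functions vanish off the unit cube, which has measure one, so `L₂` convergence implies `L₁`
convergence. -/
theorem tendsto_ft (h : Approximation r f g φ) (hf : Continuous f) (z : Fin d → ℝ) :
    Tendsto (fun k => ft (φ k) z) atTop (𝓝 (ft f z)) := by
  set μ : Measure (Fin d → ℝ) := volume.restrict (Set.Icc (0 : Fin d → ℝ) 1) with hμ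
  have : IsProbabilityMeasure μ := ⟨by simp [hμ, volume_Icc_zero_one]⟩
  have hlim := (Lp.tendsto_Lp_iff_tendsto_eLpNorm'' _ (fun k => (h.smoothCompact k).memLp) f
    h.memLp).1 h.tendsto
  have hfm : MemLp f 1 μ := (h.memLp.restrict _).mono_exponent (by norm_num)
  have hset {u : (Fin d → ℝ) → ℝ} (hu : ∀ x ∉ Set.Icc (0 : Fin d → ℝ) 1, u x = 0) :
      ft u z = ∫ y, u y • character z y ∂μ :=
    (setIntegral_eq_integral_of_forall_compl_eq_zero fun x hx => by rw [hu x hx, zero_smul]).symm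
  rw [hset fun x hx => h.eq_zero_of_notMem_Icc hf hx]
  have hk (k : ℕ) := hset (u := φ k) fun x hx =>
    h.eq_zero_of_notMem k fun hx' => hx (openCube_subset_Icc hx')
  simp only [hk]
  have hc := (continuous_character z)
  refine tendsto_integral_of_L1' _ ?_ (.of_forall fun k => ?_) ?_
  · exact ((memLp_one_iff_integrable.1 hfm).smul_bdd 1 hc.aestronglyMeasurable
      (.of_forall fun y => (norm_character z y).le)).aestronglyMeasurable
  · exact (integrable_smul_character (h.smoothCompact k).integrable z).integrableOn
  · refine tendsto_of_tendsto_of_tendsto_of_le_of_le tendsto_const_nhds hlim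
      (fun _ => zero_le) fun k => ?_
    have h1 : eLpNorm ((fun y => φ k y • character z y) - fun y => f y • character z y) 1 μ =
        eLpNorm (φ k - f) 1 μ := by
      refine eLpNorm_congr_norm_ae (.of_forall fun y => ?_)
      simp only [Pi.sub_apply]
      rw [← sub_smul, norm_smul, norm_character, mul_one]
    refine h1.le.trans ((eLpNorm_le_eLpNorm_of_exponent_le (by norm_num) ?_).trans
      (eLpNorm_mono_measure _ Measure.restrict_le_self))
    exact ((h.smoothCompact k).continuous.sub hf).aestronglyMeasurable

end Approximation

end Space

end Frolov

namespace Frolov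

open MeasureTheory Filter Matrix
open scoped Topology

/-! ### Numerical constants -/

section Constants

variable {d : ℕ}

/-- The alternative `m = 0` is for equal smoothnesses: `nextSmoothness` is then `0`, which makes the
base negative, but the exponent is zero. -/
theorem rpow_neg_half_sq {x : ℝ} {m : ℕ} (hx : 0 ≤ x ∨ m = 0) :
    (x ^ (-((m : ℝ) / 2))) ^ 2 = (x⁻¹) ^ m := by
  rcases hx with hx | rfl
  · rw [← Real.rpow_natCast, ← Real.rpow_mul hx, ← Real.rpow_natCast, Real.inv_rpow hx,
      ← Real.rpow_neg hx]
    congr 1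
    push_cast
    ring
  · simp

theorem rpow_half_sq {x : ℝ} {m : ℕ} (hx : 0 ≤ x ∨ m = 0) :
    (x ^ ((m : ℝ) / 2)) ^ 2 = x ^ m := by
  rcases hx with hx | rfl
  · rw [← Real.rpow_natCast, ← Real.rpow_mul hx, ← Real.rpow_natCast]
    congr 1
    push_cast
    ring
  · simp

theorem numMin_le (r : Fin d → ℕ) : numMin r ≤ d :=
  (Finset.card_le_univ _).trans (by simp)

theorem exists_ne_leastSmoothness {r : Fin d → ℕ} (h : d - numMin r ≠ 0) :
    ∃ i, r i ≠ leastSmoothness r := by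
  by_contra! hc
  apply h
  rw [numMin, Finset.filter_true_of_mem fun i _ => hc i]
  simp

/-- The constant in the embedding of one variable. -/
noncomputable def embeddingConst (s : ℕ) : ℝ :=
  1 / (((s - 1).factorial : ℝ) ^ 2 * (2 * (s : ℝ) - 1) * (2 * (s : ℝ)))

theorem embeddingConst_nonneg {s : ℕ} (hs : 1 ≤ s) : 0 ≤ embeddingConst s := by
  have : (1 : ℝ) ≤ s := by exact_mod_cast hs
  have h2 : (0 : ℝ) ≤ 2 * s - 1 := by linarith
  unfold embeddingConst
  positivity

/-- Trades the Poincaré factor for the one in `constant`: for `s = 1` this is `3 / 2 ≤ 15 / 8`, and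
for `s ≥ 2` already `1 + 1 / 4 = 5 / 4`. -/
theorem one_add_half_pow_le {s : ℕ} (hs : 1 ≤ s) :
    1 + (1 / 2 : ℝ) ^ s ≤ 5 / 4 * (1 + embeddingConst s) := by
  rcases hs.eq_or_lt with rfl | hs'
  · norm_num [embeddingConst]
  · have h1 : (1 / 2 : ℝ) ^ s ≤ (1 / 2) ^ 2 :=
      pow_le_pow_of_le_one (by norm_num) (by norm_num) hs'
    have := embeddingConst_nonneg hs
    linarith

theorem constant_sq {r : Fin d → ℕ} (hr : ∀ i, 1 ≤ r i) (hd : 0 < d) :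
    constant r ^ 2 = 4 ^ (d + 1) *
      ((1 - (1 / 4 : ℝ) ^ (nextSmoothness r - leastSmoothness r))⁻¹) ^ (d - numMin r) *
      ((1 - 2 * (1 / 4 : ℝ) ^ leastSmoothness r)⁻¹) ^ numMin r *
      ∏ i, (1 + embeddingConst (r i)) := by
  have h1 : (((1 - (2 : ℝ) ^ (-(2 * ((nextSmoothness r : ℝ) - leastSmoothness r)))) ^
      (-(((d : ℝ) - numMin r) / 2)))) ^ 2 =
      ((1 - (1 / 4 : ℝ) ^ (nextSmoothness r - leastSmoothness r))⁻¹) ^ (d - numMin r) := by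
    rw [← Nat.cast_sub (numMin_le r)]
    by_cases h0 : d - numMin r = 0
    · simp [h0]
    · obtain ⟨i, hi⟩ := exists_ne_leastSmoothness h0
      have hlt := leastSmoothness_lt_nextSmoothness hi
      have h2 : (2 : ℝ) ^ (-(2 * ((nextSmoothness r : ℝ) - leastSmoothness r))) =
          (1 / 4 : ℝ) ^ (nextSmoothness r - leastSmoothness r) := by
        rw [← Nat.cast_sub hlt.le, neg_mul_eq_neg_mul, Real.rpow_mul (by norm_num),
          Real.rpow_natCast]
        congr 1
        rw [Real.rpow_neg (by norm_num)]
        norm_num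
      rw [h2, rpow_neg_half_sq]
      left
      have : (1 / 4 : ℝ) ^ (nextSmoothness r - leastSmoothness r) ≤ 1 :=
        pow_le_one₀ (by norm_num) (by norm_num)
      linarith
  have h2 : (((1 - (2 : ℝ) ^ (1 - 2 * (leastSmoothness r : ℝ))) ^ (-((numMin r : ℝ) / 2)))) ^ 2 =
      ((1 - 2 * (1 / 4 : ℝ) ^ leastSmoothness r)⁻¹) ^ numMin r := by
    have h3 : (2 : ℝ) ^ (1 - 2 * (leastSmoothness r : ℝ)) = 2 * (1 / 4 : ℝ) ^ leastSmoothness r := by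
      rw [Real.rpow_sub (by norm_num), Real.rpow_one, Real.rpow_mul (by norm_num),
        Real.rpow_natCast, div_eq_mul_inv, ← inv_pow]
      norm_num
    rw [h3, rpow_neg_half_sq]
    left
    obtain ⟨j, hj⟩ := exists_eq_leastSmoothness r ⟨0, hd⟩
    have : (1 / 4 : ℝ) ^ leastSmoothness r ≤ (1 / 4) ^ 1 :=
      pow_le_pow_of_le_one (by norm_num) (by norm_num) (hj ▸ hr j)
    linarith
  have h3 : ((∑ e : Finset (Fin d), ∏ i ∈ e, embeddingConst (r i)) ^ (1 / 2 : ℝ)) ^ 2 =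
      ∏ i, (1 + embeddingConst (r i)) := by
    rw [← Real.sqrt_eq_rpow, Real.sq_sqrt (Finset.sum_nonneg fun e _ =>
      Finset.prod_nonneg fun i _ => embeddingConst_nonneg (hr i)), Finset.prod_one_add,
      Finset.powerset_univ]
  have h4 : ((2 : ℝ) ^ (d + 1)) ^ 2 = 4 ^ (d + 1) := by
    rw [← pow_mul, mul_comm, pow_mul]; norm_num
  rw [constant, mul_pow, mul_pow, mul_pow, h1, h2, h4]
  congr 1

theorem constant_nonneg {r : Fin d → ℕ} (hr : ∀ i, 1 ≤ r i) (hd : 0 < d) : 0 ≤ constant r := by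
  have hsum : 0 ≤ ∑ e : Finset (Fin d), ∏ i ∈ e, embeddingConst (r i) :=
    Finset.sum_nonneg fun e _ => Finset.prod_nonneg fun i _ => embeddingConst_nonneg (hr i)
  rw [constant]
  refine mul_nonneg (mul_nonneg (mul_nonneg (by positivity) ?_) ?_) (Real.rpow_nonneg hsum _)
  · by_cases h0 : d - numMin r = 0
    · have : (d : ℝ) - numMin r = 0 := by
        rw [← Nat.cast_sub (numMin_le r), h0, Nat.cast_zero]
      simp [this]
    · obtain ⟨i, hi⟩ := exists_ne_leastSmoothness h0
      have hlt : (leastSmoothness r : ℝ) ≤ nextSmoothness r := by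
        exact_mod_cast (leastSmoothness_lt_nextSmoothness hi).le
      refine Real.rpow_nonneg (sub_nonneg.2 (Real.rpow_le_one_of_one_le_of_nonpos (by norm_num) ?_)) _
      linarith
  · obtain ⟨j, hj⟩ := exists_eq_leastSmoothness r ⟨0, hd⟩
    have : (1 : ℝ) ≤ leastSmoothness r := by exact_mod_cast hj ▸ hr j
    refine Real.rpow_nonneg (sub_nonneg.2 (Real.rpow_le_one_of_one_le_of_nonpos (by norm_num) ?_)) _
    linarith

/-- The factors come, in order, from the Bessel constant, the point count, the logarithm, the
non-minimal geometric series and the Poincaré inequality. Both `3 / 2` and `8 / 7` are at most `8 /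
5`, and `8 / 5 * 5 / 4 = 2`. -/
theorem constant_comparison {e : ℕ} (he : 1 ≤ e) (hed : e ≤ d) :
    2 * 2 ^ d * (3 / 2 : ℝ) ^ (e - 1) * (8 / 7) ^ (d - e) * (5 / 4) ^ d ≤ 4 ^ (d + 1) := by
  have h1 : (3 / 2 : ℝ) ^ (e - 1) ≤ (8 / 5) ^ (e - 1) :=
    pow_le_pow_left₀ (by norm_num) (by norm_num) _
  have h2 : (8 / 7 : ℝ) ^ (d - e) ≤ (8 / 5) ^ (d - e) :=
    pow_le_pow_left₀ (by norm_num) (by norm_num) _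
  have h3 : (8 / 5 : ℝ) ^ (e - 1) * (8 / 5) ^ (d - e) ≤ (8 / 5) ^ d := by
    rw [← pow_add]
    exact pow_le_pow_right₀ (by norm_num) (by omega)
  calc 2 * 2 ^ d * (3 / 2 : ℝ) ^ (e - 1) * (8 / 7) ^ (d - e) * (5 / 4) ^ d
      = 2 * 2 ^ d * ((3 / 2 : ℝ) ^ (e - 1) * (8 / 7) ^ (d - e)) * (5 / 4) ^ d := by ring
    _ ≤ 2 * 2 ^ d * (8 / 5 : ℝ) ^ d * (5 / 4) ^ d := by
      gcongr
      exact (mul_le_mul h1 h2 (by positivity) (by positivity)).trans h3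
    _ = 2 * 4 ^ d := by
      rw [mul_assoc, mul_assoc, ← mul_pow, ← mul_pow]; norm_num
    _ ≤ 4 ^ (d + 1) := by
      rw [pow_succ]; linarith [pow_pos (by norm_num : (0 : ℝ) < 4) d]

end Constants

/-! ### The error estimate -/

section Error

variable {d : ℕ}

/-- The lattice `A ℤ^d`, parametrized by `k ↦ A k`. -/
noncomputable def latticeHom (A : Matrix (Fin d) (Fin d) ℝ) : (Fin d → ℤ) →+ (Fin d → ℝ) where
  toFun k := A *ᵥ latticePoint k
  map_zero' := by
    have : latticePoint (0 : Fin d → ℤ) = 0 := by funext i; simp [latticePoint]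
    rw [this, mulVec_zero]
  map_add' k l := by
    have : latticePoint (k + l) = latticePoint k + latticePoint l := by
      funext i; simp [latticePoint]
    rw [this, mulVec_add]

/-- The dual lattice of `A ℤ^d`, parametrized by `k ↦ (Aᵀ)⁻¹ k`. -/
noncomputable def dualLattice (A : Matrix (Fin d) (Fin d) ℝ) : (Fin d → ℤ) →+ (Fin d → ℝ) :=
  latticeHom (Aᵀ)⁻¹

theorem transpose_mulVec_dualLattice {A : Matrix (Fin d) (Fin d) ℝ} (hA : A.det ≠ 0)
    (k : Fin d → ℤ) : Aᵀ *ᵥ dualLattice A k = latticePoint k := by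
  have : IsUnit (Aᵀ).det := by rw [det_transpose]; exact hA.isUnit
  change Aᵀ *ᵥ ((Aᵀ)⁻¹ *ᵥ latticePoint k) = _
  rw [mulVec_mulVec, mul_nonsing_inv _ this, one_mulVec]

variable {P : Polynomial ℤ} {ξ : Fin d → ℝ} {n : ℕ}

theorem IsAdmissible.det_cubatureMatrix_ne_zero (hP : IsAdmissible P ξ) (hn : 1 ≤ n) :
    (cubatureMatrix ξ n).det ≠ 0 := by
  have h := hP.abs_det_cubatureMatrix n
  have hn' : (0 : ℝ) < n := by exact_mod_cast hn
  rw [← abs_pos, h]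
  positivity

/-- The count in a unit box is at most `n D_P + 1`, and `n D_P ≥ 1` absorbs the `+ 1`. -/
theorem IsAdmissible.card_translate_le (hP : IsAdmissible P ξ) (hn : 1 ≤ n) (x : Fin d → ℝ)
    (F : Finset (Fin d → ℤ))
    (hF : ∀ m ∈ F, cubatureMatrix ξ n *ᵥ (x + latticePoint m) ∈ openCube d) :
    (F.card : ℝ) ≤ 2 * n * discr ξ := by
  have hn' : (1 : ℝ) ≤ n := by exact_mod_cast hn
  have hD := hP.one_le_discr
  have h := card_lattice_le (latticeHom (cubatureMatrix ξ n)) (τ := (n * discr ξ)⁻¹)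
    (by positivity) (fun k hk => hP.le_prod_cubatureMatrix n hk) ⟨0, hP.pos⟩
    (cubatureMatrix ξ n *ᵥ x) 0 1 (fun _ => one_pos) F (by
      intro k hk i
      have h1 := hF k hk i (Set.mem_univ i)
      rw [mulVec_add] at h1
      exact ⟨h1.1.le, h1.2.trans_eq (by simp)⟩)
  simp only [Pi.one_apply, Finset.prod_const_one, one_div, inv_inv] at h
  have : 1 ≤ n * discr ξ := one_le_mul_of_one_le_of_one_le hn' hD
  linarith

theorem IsAdmissible.sum_weighted_norm_ft_sq_le (hP : IsAdmissible P ξ) (hn : 1 ≤ n)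
    {r : Fin d → ℕ} {f g : (Fin d → ℝ) → ℝ} {φ : ℕ → (Fin d → ℝ) → ℝ}
    (h : Approximation r f g φ) (hf : Continuous f) (F : Finset (Fin d → ℤ)) :
    ∑ k ∈ F, (∏ i, (1 + (2 * Real.pi * dualLattice (cubatureMatrix ξ n) k i) ^ (2 * r i))) *
        ‖ft f (dualLattice (cubatureMatrix ξ n) k)‖ ^ 2 ≤
      2 * discr ξ * (∏ i, (1 + (1 / 2 : ℝ) ^ r i)) * spaceNorm r f ^ 2 := by
  set A := cubatureMatrix ξ n with hAdef
  have hA : A.det ≠ 0 := hP.det_cubatureMatrix_ne_zero hn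
  have hn' : (0 : ℝ) < n := by exact_mod_cast hn
  have hD := hP.discr_pos
  refine le_of_tendsto_of_tendsto' (tendsto_finsetSum F fun k _ =>
    ((h.tendsto_ft hf (dualLattice A k)).norm.pow 2).const_mul _)
    (h.tendsto_integral_sq.const_mul (2 * discr ξ * ∏ i, (1 + (1 / 2 : ℝ) ^ r i))) fun j => ?_
  simp only [← sum_norm_ft_mixedDeriv_sq (h.smoothCompact j)]
  rw [Finset.sum_comm, mul_assoc (2 * discr ξ)]
  refine le_trans ?_ (mul_le_mul_of_nonneg_left (sum_integral_mixedDeriv_sq_le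
    (h.smoothCompact j) (h.tsupport_subset j) r) (by positivity))
  rw [Finset.mul_sum]
  refine Finset.sum_le_sum fun e _ => ?_
  have hs := (h.smoothCompact j).mixedDeriv fun i => if i ∈ e then r i else 0
  have := sum_norm_ft_sq_le hA (M := 2 * n * discr ξ) (by positivity)
    (fun x F hF => hP.card_translate_le hn x F hF) (transpose_mulVec_dualLattice hA)
    hs.integrable hs.integrable_sq (fun x hx => h.mixedDeriv_eq_zero_of_notMem j _ hx) F
  rw [hP.abs_det_cubatureMatrix n, show (n : ℝ)⁻¹ * (2 * n * discr ξ) = 2 * discr ξ by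
    field_simp] at this
  exact this

/-- The cubature error is a sum of values of the Fourier transform over the dual lattice. -/
theorem IsAdmissible.abs_cubature_sub_le (hP : IsAdmissible P ξ) (hn : 1 ≤ n)
    {f : (Fin d → ℝ) → ℝ} (hf : Continuous f)
    (h0 : ∀ x ∉ Set.Icc (0 : Fin d → ℝ) 1, f x = 0) {R : ℝ}
    (hR : ∀ F : Finset (Fin d → ℤ), (∀ k ∈ F, k ≠ 0) →
      ∑ k ∈ F, ‖ft f (dualLattice (cubatureMatrix ξ n) k)‖ ≤ R) :
    |cubature ξ n f - exactIntegral f| ≤ R := by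
  classical
  set A := cubatureMatrix ξ n with hAdef
  have hA : A.det ≠ 0 := hP.det_cubatureMatrix_ne_zero hn
  have hs : HasCompactSupport f := HasCompactSupport.intro isCompact_Icc h0
  set c : (Fin d → ℤ) → ℂ := fun k => ft f (dualLattice A k) with hc
  have hsum : Summable c := by
    -- Bounded finite sums away from `0`, together with the single term at `0`, give the absolute
    -- summability that Poisson summation requires.
    refine Summable.of_norm (summable_of_sum_le (c := ‖c 0‖ + R) (fun _ => norm_nonneg _)
      fun F => ?_)
    refine (Finset.sum_le_sum_of_subset_of_nonneg (Finset.subset_insert 0 F)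
      fun _ _ _ => norm_nonneg _).trans ?_
    rw [← Finset.insert_erase (Finset.mem_insert_self 0 F),
      Finset.sum_insert (Finset.notMem_erase _ _)]
    gcongr
    exact hR _ fun k hk => Finset.ne_of_mem_erase hk
  have hpois := tsum_eq_tsum_ft hA (transpose_mulVec_dualLattice hA) hf hs hsum
  have hQ : (cubature ξ n f : ℂ) = ∑' k, c k := by
    rw [← hpois, hP.abs_det_cubatureMatrix n, cubature, ← Complex.ofReal_tsum,
      ← Complex.ofReal_mul, one_div]
    rfl
  have hI : (exactIntegral f : ℂ) = c 0 := by
    have h1 : exactIntegral f = ∫ x, f x :=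
      setIntegral_eq_integral_of_forall_compl_eq_zero h0
    have h2 (y : Fin d → ℝ) : f y • character (0 : Fin d → ℝ) y = (f y : ℂ) := by
      simp [character]
    simp only [hc, map_zero, ft, h2, h1]
    exact integral_complex_ofReal.symm
  have hbound : ‖(∑' k, c k) - c 0‖ ≤ R := by
    refine le_of_tendsto ((hsum.hasSum.sub_const (c 0)).norm) ?_
    filter_upwards [eventually_ge_atTop {0}] with F hF
    rw [← Finset.add_sum_erase F c (hF (Finset.mem_singleton_self 0)), add_sub_cancel_left]
    exact (norm_sum_le _ _).trans (hR _ fun k hk => Finset.ne_of_mem_erase hk)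
  rw [← hQ, ← hI, ← Complex.ofReal_sub, Complex.norm_real] at hbound
  exact hbound

/-- The error bound for Frolov's cubature rule on `H^r_mix`. -/
theorem IsAdmissible.abs_cubature_sub_exactIntegral_le (hP : IsAdmissible P ξ)
    (r : Fin d → ℕ) (hr : ∀ i, 1 ≤ r i) (hn : 1 ≤ n)
    (hlog : numMin r = 1 ∨ 1 ≤ 2 + Real.log (n / discr ξ))
    (f : (Fin d → ℝ) → ℝ) (hf : MemHmix r f) :
    |cubature ξ n f - exactIntegral f| ≤
      constant r
        * (max (discr ξ) ((2 * cellSize ξ) ^ d / n)) ^ (1 / 2 : ℝ)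
        * (discr ξ / n) ^ leastSmoothness r
        * (2 + Real.log (n / discr ξ)) ^ (((numMin r : ℝ) - 1) / 2)
        * spaceNorm r f := by
  obtain ⟨g, φ, h⟩ := hf.exists_approximation
  have hd := hP.pos
  have hD := hP.discr_pos
  have hn' : (0 : ℝ) < n := by exact_mod_cast hn
  obtain ⟨j, hj⟩ := exists_eq_leastSmoothness r ⟨0, hd⟩
  have hη := one_le_numMin hj
  set T : ℝ := n / discr ξ with hT
  have hTpos : 0 < T := by positivity
  set mx := max (discr ξ) ((2 * cellSize ξ) ^ d / n) with hmx
  -- The maximum enters only through this bound: the Bessel constant is `2 D_P`, whatever the shape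
  -- of the fundamental cell.
  have hmxD : discr ξ ≤ mx := le_max_left _ _
  have hN : 0 ≤ spaceNorm r f := Real.sqrt_nonneg _
  -- For `numMin r = 1` the base may be negative, but its exponent vanishes.
  have hlog' : 0 ≤ 2 + Real.log T ∨ numMin r - 1 = 0 := by
    rcases hlog with h1 | h1
    · right; omega
    · left; linarith
  have hlogn : 0 ≤ (2 + Real.log T) ^ (numMin r - 1) := by
    rcases hlog' with h1 | h1
    · positivity
    · simp [h1]
  have hcast : ((numMin r : ℝ) - 1) / 2 = ((numMin r - 1 : ℕ) : ℝ) / 2 := by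
    rw [Nat.cast_sub hη, Nat.cast_one]
  have hlogr : 0 ≤ (2 + Real.log T) ^ (((numMin r : ℝ) - 1) / 2) := by
    rw [hcast]
    rcases hlog' with h1 | h1
    · positivity
    · simp [h1]
  have hL : ((dyadicExp T : ℝ) + 1) ^ (numMin r - 1) ≤
      (3 / 2) ^ (numMin r - 1) * (2 + Real.log T) ^ (numMin r - 1) := by
    rcases hlog with h1 | h1
    · simp [h1]
    · rw [← mul_pow]
      exact pow_le_pow_left₀ (by positivity) (dyadicExp_add_one_le h1) _
  have hprod : ∏ i, (1 + (1 / 2 : ℝ) ^ r i) ≤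
      (5 / 4) ^ d * ∏ i, (1 + embeddingConst (r i)) := by
    have : (5 / 4 : ℝ) ^ d = ∏ _i : Fin d, (5 / 4 : ℝ) := by
      rw [Finset.prod_const, Finset.card_univ, Fintype.card_fin]
    rw [this, ← Finset.prod_mul_distrib]
    exact Finset.prod_le_prod (fun i _ => by positivity) fun i _ => one_add_half_pow_le (hr i)
  refine hP.abs_cubature_sub_le hn hf.continuous
    (fun x hx => h.eq_zero_of_notMem_Icc hf.continuous hx) fun F hF => ?_
  have hC := constant_nonneg hr hd
  refine abs_le_of_sq_le_sq' ?_ (by positivity) |>.2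
  set A := cubatureMatrix ξ n with hA
  set ν : (Fin d → ℤ) → ℝ := fun k =>
    ∏ i, (1 + (2 * Real.pi * dualLattice A k i) ^ (2 * r i)) with hν
  have hνpos (k : Fin d → ℤ) : 0 < ν k := Finset.prod_pos fun i _ => by
    have : 0 ≤ (2 * Real.pi * dualLattice A k i) ^ (2 * r i) := Even.pow_nonneg ⟨r i, by ring⟩ _
    positivity
  -- Cauchy–Schwarz with weight `ν`: the first factor depends only on the dual lattice, the second
  -- is controlled by the norm of `f`.
  have hcs : (∑ k ∈ F, ‖ft f (dualLattice A k)‖) ^ 2 ≤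
      (∑ k ∈ F, (ν k)⁻¹) * ∑ k ∈ F, ν k * ‖ft f (dualLattice A k)‖ ^ 2 :=
    Finset.sum_sq_le_sum_mul_sum_of_sq_le_mul F (fun k _ => (inv_pos.2 (hνpos k)).le)
      (fun k _ => mul_nonneg (hνpos k).le (by positivity)) fun k _ => by
        rw [inv_mul_cancel_left₀ (hνpos k).ne']
  refine hcs.trans ?_
  have hS := lattice_sum_le (dualLattice A) hTpos (fun k hk => hP.le_prod_dual hn hk
    (transpose_mulVec_dualLattice (hP.det_cubatureMatrix_ne_zero hn) k)) hj hr F hF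
  have hW := hP.sum_weighted_norm_ft_sq_le hn h hf.continuous F
  set Q := ((1 - (1 / 4 : ℝ) ^ (nextSmoothness r - leastSmoothness r))⁻¹) ^ (d - numMin r)
    with hQ
  set Y := ((1 - 2 * (1 / 4 : ℝ) ^ leastSmoothness r)⁻¹) ^ numMin r with hY
  have hQ0 : 0 ≤ Q := pow_nonneg (inv_nonneg.2 (sub_nonneg.2
    (pow_le_one₀ (by norm_num) (by norm_num)))) _
  have hY0 : 0 ≤ Y := by
    have : (1 / 4 : ℝ) ^ leastSmoothness r ≤ (1 / 4) ^ 1 :=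
      pow_le_pow_of_le_one (by norm_num) (by norm_num) (hj ▸ hr j)
    exact pow_nonneg (inv_nonneg.2 (by linarith)) _
  set E := ∏ i, (1 + embeddingConst (r i)) with hE
  have hE0 : 0 ≤ E := Finset.prod_nonneg fun i _ => by
    have := embeddingConst_nonneg (hr i); positivity
  have hsq : (constant r * mx ^ (1 / 2 : ℝ) * (discr ξ / n) ^ leastSmoothness r *
      (2 + Real.log T) ^ (((numMin r : ℝ) - 1) / 2) * spaceNorm r f) ^ 2 =
      4 ^ (d + 1) * Q * Y * E * mx * (T⁻¹) ^ (2 * leastSmoothness r) *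
        (2 + Real.log T) ^ (numMin r - 1) * spaceNorm r f ^ 2 := by
    rw [mul_pow, mul_pow, mul_pow, mul_pow, constant_sq hr hd, hcast, rpow_half_sq hlog',
      ← Real.sqrt_eq_rpow, Real.sq_sqrt (hD.le.trans hmxD), hT, inv_div, ← pow_mul,
      mul_comm 2 (leastSmoothness r)]
  rw [hsq]
  have hνinv (k : Fin d → ℤ) : (ν k)⁻¹ =
      ∏ i, (1 + (2 * Real.pi * dualLattice A k i) ^ (2 * r i))⁻¹ :=
    (Finset.prod_inv_distrib _).symm
  simp only [hνinv]
  have hcomp := constant_comparison hη (numMin_le r)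
  refine (mul_le_mul hS hW (Finset.sum_nonneg fun k _ => mul_nonneg (hνpos k).le (by positivity))
    (by positivity)).trans ?_
  calc _ ≤ 2 ^ d * (T⁻¹) ^ (2 * leastSmoothness r) *
        ((3 / 2) ^ (numMin r - 1) * (2 + Real.log T) ^ (numMin r - 1)) * Q * Y *
        (8 / 7) ^ (d - numMin r) * (2 * mx * ((5 / 4) ^ d * E) * spaceNorm r f ^ 2) := by
        gcongr
    _ = (2 * 2 ^ d * (3 / 2 : ℝ) ^ (numMin r - 1) * (8 / 7) ^ (d - numMin r) * (5 / 4) ^ d) *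
        (Q * Y * E * mx * (T⁻¹) ^ (2 * leastSmoothness r) *
          (2 + Real.log T) ^ (numMin r - 1) * spaceNorm r f ^ 2) := by ring
    _ ≤ 4 ^ (d + 1) * (Q * Y * E * mx * (T⁻¹) ^ (2 * leastSmoothness r) *
          (2 + Real.log T) ^ (numMin r - 1) * spaceNorm r f ^ 2) :=
        mul_le_mul_of_nonneg_right hcomp (by
          have := hD.le.trans hmxD
          positivity)
    _ = _ := by ring

end Error

end Frolov

theorem mainTheorem1 {d : ℕ} (P : Polynomial ℤ) (ξ : Fin d → ℝ) (hP : Frolov.IsAdmissible P ξ)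
    (r : Fin d → ℕ) (hr : ∀ i, 1 ≤ r i) (n : ℕ) (hn : 1 ≤ n)
    (hlog : Frolov.numMin r = 1 ∨ 1 ≤ 2 + Real.log (n / Frolov.discr ξ))
    (f : (Fin d → ℝ) → ℝ) (hf : Frolov.MemHmix r f) :
    |Frolov.cubature ξ n f - Frolov.exactIntegral f| ≤
      Frolov.constant r
        * (max (Frolov.discr ξ) ((2 * Frolov.cellSize ξ) ^ d / n)) ^ (1 / 2 : ℝ)
        * (Frolov.discr ξ / n) ^ Frolov.leastSmoothness r
        * (2 + Real.log (n / Frolov.discr ξ)) ^ (((Frolov.numMin r : ℝ) - 1) / 2)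
        * Frolov.spaceNorm r f :=
  hP.abs_cubature_sub_exactIntegral_le r hr hn hlog f hf
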